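/- For each $n$ let $\mathbf y=\sum_{g=1}^{G_n}\mathbf X_g\boldsymbol\beta_g^0+\boldsymbol\epsilon$ with $\boldsymbol\epsilon\sim\mathcal N_n(\mathbf 0,\sigma^2 I_n)$, where $\sigma>0$ is known and does not depend on $n$, $G_n\le n$, $\mathbf X_g$ is a deterministic $n\times m_g$ matrix, the full design $\mathbf X=[\mathbf X_1,\dots,\mathbf X_{G_n}]$ is block orthogonal ($\mathbf X_g^{\mathrm T}\mathbf X_h=\mathbf 0$ for $g\ne h$), and the group sizes are bounded: $\sup_n\max_g m_g<\infty$. (The design and $\boldsymbol\beta^0$ may vary with $n$.) Let $\mathcal A=\{g:\boldsymbol\beta_g^0\neq\mathbf 0\}$ and $G_{\mathcal A_n}=|\mathcal A|$. Consider the Bayesian hierarchical model $\mathbf y\mid\boldsymbol\beta\sim\mathcal N_n(\mathbf X\boldsymbol\beta,\sigma^2I_n)$, $\boldsymbol\beta_g\mid\lambda_g^2\sim\mathcal N_{m_g}(\mathbf 0,\lambda_g^2\sigma^2\tau^2(\mathbf X_g^{\mathrm T}\mathbf X_g)^{-1})$ independently, and $\lambda_g^2$ independent with probability density proportional to $t^{-a-1}L(t)$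 on $(0,\infty)$, where $a>0$ and $L:(0,\infty)\to(0,\infty)$ is measurable, non-constant and slowly varying at infinity. Put $\kappa_g=1/(1+\lambda_g^2\tau^2)$, and let $E(\cdot\mid\tau,\mathbf y)$ be posterior expectation for fixed $\tau$ and $\sigma$. With constants $c_1\ge2$, $c_2\ge1$ and the least squares estimates $\widehat{\boldsymbol\beta}_g$, let $$\widehat\tau=\max\Big\{\frac1{G_n},\ \frac1{c_2G_n}\sum_{g=1}^{G_n}\mathbf 1\Big(\frac{\widehat{\boldsymbol\beta}_g^{\mathrm T}\mathbf X_g^{\mathrm T}\mathbf X_g\widehat{\boldsymbol\beta}_g}{\sigma^2}>c_1\log G_n\Big)\Big\}$$ and define the empirical Bayes half-thresholding estimator $$\widehat{\boldsymbol\beta}_{g,EB}^{\mathrm{HT}}=E(\boldsymbol\beta_g\mid\widehat\tau,\mathbf y)\,\mathbf 1\big\{E(1-\kappa_g\mid\widehat\tau,\mathbf y)>\tfrac12\big\}.$$ Assume: (i) there are constants $0<C_1\le C_2<\infty$ with $C_1\le\frac1n e_{\min}(\mathbf X^{\mathrm T}\mathbf X)\le\frac1n e_{\max}(\mathbf X^{\mathrm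 T}\mathbf X)\le C_2$ for all $n$, where $e_{\min}$ and $e_{\max}$ denote the smallest and largest eigenvalue; (ii) there is a constant $C_3>0$ with $\min_j|\beta^0_{gj}|>C_3$ for all $g\in\mathcal A$ and all $n$; (iii) $a\ge\frac12$, there are $c_0,t_0>0$ with $L(t)\ge c_0$ for all $t\ge t_0$, and $\sup_{t>0}L(t)<\infty$; (iv) $G_n^{\epsilon_1}\lesssim G_{\mathcal A_n}\lesssim G_n^{\epsilon_2}$ for some $0\le\epsilon_1<\epsilon_2<\frac12$, where $u_n\lesssim v_n$ means $u_n\le Cv_n$ for a constant $C$ and all large $n$. Let $\mathbf X_{\mathcal A}$ collect the columns of the active groups, let $\boldsymbol\Sigma_{\mathcal A}=\mathbf X_{\mathcal A}^{\mathrm T}\mathbf X_{\mathcal A}$ with positive semidefinite square root $\boldsymbol\Sigma_{\mathcal A}^{1/2}$, and write $\widehat{\boldsymbol\beta}_{\mathcal A,EB}^{\mathrm{HT}}$, $\boldsymbol\beta_{\mathcal A}^0$ for the subvectors of the active groups. Then for all vectors $\boldsymbol\alpha=\boldsymbol\alpha_n$ with $\|\boldsymbol\alpha_n\|=1$ (for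 all large $n$), $$\boldsymbol\alpha^{\mathrm T}\boldsymbol\Sigma_{\mathcal A}^{1/2}\big(\widehat{\boldsymbol\beta}_{\mathcal A,EB}^{\mathrm{HT}}-\boldsymbol\beta_{\mathcal A}^0\big)\xrightarrow{d}\mathcal N(0,\sigma^2)\qquad(n\to\infty).$$ -/

import Mathlib

open MeasureTheory ProbabilityTheory Filter Topology Matrix
open scoped MatrixOrder

noncomputable section

/-- A design for `n` observations: a number of groups of regressors, the size of each group, and
the `n × m_g` design matrix of each group. -/
structure GroupedDesign (n : ℕ) where
  numGroups : ℕ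
  size : Fin numGroups → ℕ
  block : (g : Fin numGroups) → Matrix (Fin n) (Fin (size g)) ℝ

namespace GroupedDesign

variable {n : ℕ} (D : GroupedDesign n)

/-- Indices `(g, j)` of the individual regressors. -/
abbrev Index : Type := Σ g : Fin D.numGroups, Fin (D.size g)

/-- Grouped coefficient vectors `β = (β_1, …, β_G)`. -/
abbrev Coef : Type := (g : Fin D.numGroups) → EuclideanSpace ℝ (Fin (D.size g))

/-- The full design matrix `X = [X_1, …, X_G]`. -/
def matrix : Matrix (Fin n) D.Index ℝ := Matrix.of fun i k => D.block k.1 i k.2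

/-- Distinct blocks have orthogonal columns: `X_gᵀ X_h = 0` for `g ≠ h`. -/
def BlockOrthogonal : Prop := ∀ g h, g ≠ h → (D.block g)ᵀ * D.block h = 0

/-- The Gram matrix `X_gᵀ X_g` of one group. -/
def gram (g : Fin D.numGroups) : Matrix (Fin (D.size g)) (Fin (D.size g)) ℝ :=
  (D.block g)ᵀ * D.block g

/-- `Q_{n,g} = X_gᵀ X_g / n`. -/
def scaledGram (g : Fin D.numGroups) : Matrix (Fin (D.size g)) (Fin (D.size g)) ℝ :=
  (1 / (n : ℝ)) • D.gram g

lemma isHermitian_fullGram : (D.matrixᵀ * D.matrix).IsHermitian := by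
  simpa [Matrix.conjTranspose_eq_transpose_of_trivial] using
    Matrix.isHermitian_conjTranspose_mul_self D.matrix

/-- All eigenvalues of `Xᵀ X / n` lie in `[C₁, C₂]`. -/
def EigenvalueBounds (C₁ C₂ : ℝ) : Prop :=
  ∀ i, C₁ ≤ 1 / (n : ℝ) * D.isHermitian_fullGram.eigenvalues i ∧
    1 / (n : ℝ) * D.isHermitian_fullGram.eigenvalues i ≤ C₂

/-- The regression mean `X β = ∑_g X_g β_g`. -/
def mean (β : D.Coef) : EuclideanSpace ℝ (Fin n) :=
  ∑ g, WithLp.toLp 2 (D.block g *ᵥ β g)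

/-- The law `N_n(X β, σ² I_n)` of the response. -/
def responseLaw (σ : ℝ) (β : D.Coef) : Measure (EuclideanSpace ℝ (Fin n)) :=
  multivariateGaussian (D.mean β) (σ ^ 2 • 1)

/-- The density of `N_n(X β, σ² I_n)` at `y`. -/
def likelihood (σ : ℝ) (y : EuclideanSpace ℝ (Fin n)) (β : D.Coef) : ℝ :=
  (2 * Real.pi * σ ^ 2) ^ (-(n : ℝ) / 2) * Real.exp (-‖y - D.mean β‖ ^ 2 / (2 * σ ^ 2))

/-- The least squares estimate `(Xᵀ X)⁻¹ Xᵀ y`, split into its groups. -/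
def leastSquares (y : EuclideanSpace ℝ (Fin n)) : D.Coef := fun g =>
  WithLp.toLp 2 fun j => ((D.matrixᵀ * D.matrix)⁻¹ *ᵥ (D.matrixᵀ *ᵥ y)) ⟨g, j⟩

/-- The empirical Bayes estimate of the global shrinkage parameter:
`max {1/G, (1/(c₂ G)) ∑_g 1(n β̂_gᵀ Q_{n,g} β̂_g / σ² > c₁ log G)}`. -/
def tauEB (c₁ c₂ σ : ℝ) (y : EuclideanSpace ℝ (Fin n)) : ℝ :=
  max (1 / (D.numGroups : ℝ))
    (1 / (c₂ * (D.numGroups : ℝ)) * ∑ g,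
      if n * (D.leastSquares y g ⬝ᵥ (D.scaledGram g *ᵥ D.leastSquares y g)) / σ ^ 2
          > c₁ * Real.log D.numGroups
      then (1 : ℝ) else 0)

end GroupedDesign

/-- The prior of a squared local shrinkage parameter: the probability measure on `(0, ∞)` with
density proportional to `t ^ (-a-1) * L t`. -/
def localPrior (a : ℝ) (L : ℝ → ℝ) : Measure ℝ :=
  let ν := (volume.restrict (Set.Ioi (0 : ℝ))).withDensity
    fun t => ENNReal.ofReal (t ^ (-a - 1) * L t)
  (ν Set.univ)⁻¹ • ν

namespace GroupedDesign

variable {n : ℕ} (D : GroupedDesign n)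

/-- The prior of `β` given the squared local parameters `lam g = λ_g²` and the global parameter
`τ`: the `β_g` are independent with law `N(0, λ_g² σ² τ² (X_gᵀ X_g)⁻¹)`. -/
def coefPrior (σ τ : ℝ) (lam : Fin D.numGroups → ℝ) : Measure D.Coef :=
  Measure.pi fun g => multivariateGaussian 0 ((lam g * σ ^ 2 * τ ^ 2) • (D.gram g)⁻¹)

/-- Prior expectation, in the hierarchical model, of a function of the squared local parameters
and the coefficients; the squared local parameters are independent with law `localPrior a L`. -/
def priorExp {E : Type*} [NormedAddCommGroup E] [NormedSpace ℝ E] (a : ℝ) (L : ℝ → ℝ) (σ τ : ℝ)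
    (f : (Fin D.numGroups → ℝ) → D.Coef → E) : E :=
  ∫ lam, ∫ β, f lam β ∂(D.coefPrior σ τ lam) ∂(Measure.pi fun _ => localPrior a L)

/-- Posterior expectation given the data `y` (and `σ`, `τ`), by Bayes' formula. -/
def posteriorExp {E : Type*} [NormedAddCommGroup E] [NormedSpace ℝ E] (a : ℝ) (L : ℝ → ℝ)
    (σ τ : ℝ) (y : EuclideanSpace ℝ (Fin n)) (f : (Fin D.numGroups → ℝ) → D.Coef → E) : E :=
  (D.priorExp a L σ τ fun _ β => D.likelihood σ y β)⁻¹ •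
    D.priorExp a L σ τ fun lam β => D.likelihood σ y β • f lam β

/-- The posterior mean of `1 - κ_g`, where `κ_g = 1 / (1 + λ_g² τ²)`. -/
def shrinkageWeight (a : ℝ) (L : ℝ → ℝ) (σ τ : ℝ) (y : EuclideanSpace ℝ (Fin n))
    (g : Fin D.numGroups) : ℝ :=
  D.posteriorExp a L σ τ y fun lam _ => 1 - 1 / (1 + lam g * τ ^ 2)

/-- The posterior mean of `β_g`. -/
def posteriorMean (a : ℝ) (L : ℝ → ℝ) (σ τ : ℝ) (y : EuclideanSpace ℝ (Fin n)) : D.Coef :=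
  fun g => D.posteriorExp a L σ τ y fun _ β => β g

/-- The half-thresholding estimator with global parameter `τ`. -/
def halfThreshold (a : ℝ) (L : ℝ → ℝ) (σ τ : ℝ) (y : EuclideanSpace ℝ (Fin n)) : D.Coef :=
  fun g => if D.shrinkageWeight a L σ τ y g > 1 / 2 then D.posteriorMean a L σ τ y g else 0

/-- The empirical Bayes half-thresholding estimator: the estimate `tauEB` is plugged in. -/
def halfThresholdEB (a : ℝ) (L : ℝ → ℝ) (c₁ c₂ σ : ℝ) (y : EuclideanSpace ℝ (Fin n)) : D.Coef :=
  D.halfThreshold a L σ (D.tauEB c₁ c₂ σ y) y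

/-- The number of active groups, those with a nonzero coefficient vector. -/
def numActive (β : D.Coef) : ℕ := Nat.card {g : Fin D.numGroups // β g ≠ 0}

/-- Indices of the regressors that belong to active groups. -/
def ActiveIndex (β : D.Coef) : Type := {k : D.Index // β k.1 ≠ 0}

instance (β : D.Coef) : Fintype (D.ActiveIndex β) := by
  classical
  exact inferInstanceAs (Fintype {k : D.Index // β k.1 ≠ 0})

instance (β : D.Coef) : DecidableEq (D.ActiveIndex β) := Classical.decEq _

/-- The submatrix `X_A` of the columns of the active groups. -/
def activeMatrix (β : D.Coef) : Matrix (Fin n) (D.ActiveIndex β) ℝ :=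
  D.matrix.submatrix id Subtype.val

/-- `Σ_A = X_Aᵀ X_A`. -/
def activeGram (β : D.Coef) : Matrix (D.ActiveIndex β) (D.ActiveIndex β) ℝ :=
  (D.activeMatrix β)ᵀ * D.activeMatrix β

/-- The components of `b` that belong to the groups that are active for `β`. -/
def activePart (β b : D.Coef) : D.ActiveIndex β → ℝ := fun k => b k.1.1 k.1.2

/-- `αᵀ Σ_A^{1/2} (b_A - β_A)`, with the positive semidefinite square root. -/
def activeContrast (β : D.Coef) (α : EuclideanSpace ℝ (D.ActiveIndex β)) (b : D.Coef) : ℝ :=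
  α ⬝ᵥ (CFC.sqrt (D.activeGram β) *ᵥ (D.activePart β b - D.activePart β β))

end GroupedDesign

/-- Slow variation at infinity in Karamata's sense. -/
def SlowlyVarying (L : ℝ → ℝ) : Prop :=
  ∀ c : ℝ, 0 < c → Tendsto (fun x => L (c * x) / L x) atTop (𝓝 1)

/-- The class of priors: `L` is a measurable, positive, non-constant, slowly varying function on
`(0, ∞)` such that `t ^ (-a-1) * L t` can be normalised to a probability density, `a > 0`. -/
structure PolynomialTail (a : ℝ) (L : ℝ → ℝ) : Prop where
  a_pos : 0 < a
  measurable : Measurable L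
  pos : ∀ t, 0 < t → 0 < L t
  nonconstant : ¬ ∃ c, ∀ t, 0 < t → L t = c
  slowlyVarying : SlowlyVarying L
  proper : IntegrableOn (fun t : ℝ => t ^ (-a - 1) * L t) (Set.Ioi 0)

/-- `a ≥ 1/2`, and `L` is bounded above, and bounded away from zero near infinity. -/
structure TailBounds (a : ℝ) (L : ℝ → ℝ) : Prop where
  half_le : 1 / 2 ≤ a
  lower : ∃ c₀ > (0 : ℝ), ∃ t₀ > (0 : ℝ), ∀ t, t₀ ≤ t → c₀ ≤ L t
  upper : ∃ M : ℝ, ∀ t, 0 < t → L t ≤ M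

end

/-! Block orthogonality splits the likelihood into one factor per group. Given `λ_g²`, each group is
a conjugate Gaussian model whose conditional posterior mean is `1 - κ_g` times the least squares
estimate. Hence, for fixed `τ`, the posterior mean of `β_g` is the least squares estimate times `1 -
E κ_g` (`posteriorMean_eq`, `shrinkageWeight_eq`), and `E κ_g` depends on the data only through `q_g
= ‖P_g y‖² / σ²`, where `P_g` projects onto the range of `X_g`. The half-thresholding estimator is
this multiple if `E κ_g < 1/2`, and zero otherwise.

The analytic core is that `E κ_g ≤ C / q` for large `q`, uniformly for `1/(K q) ≤ τ ≤ 1`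
(`exists_integral_shrinkKernel_succ_le`, `exists_shrinkMean_le`). With `p = m_g / 2`, `E κ_g` is the
ratio of the integrals of `κ^(p+1) exp(-κ q/2)` and `κ^p exp(-κ q/2)` against `t^(-a-1) L(t)`. The
polynomial tail puts enough mass near `t ≈ q/τ²`, where `κ ≈ 1/q`; the region of small `t`
contributes only a multiple of `exp(-q/4)`, which is negligible as long as `τ` is not much smaller
than `1/q`. For the empirical Bayes `τ` it suffices that `1/G ≤ τ ≤ 1` and `G ≤ n`, so its
dependence on the data causes no difficulty.

Each active group has signal `‖X_g β_g‖²` at least of order `n`. By Chebyshev and a union bound, the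
noise spoils some active group with probability `O(G_A / n)`, which tends to zero by sparsity.
Otherwise `q_g ≥ κ n` for a fixed `κ > 0` in every active group; all of them are retained, and by
Cauchy–Schwarz the contrast differs from that of least squares by at most the root of `∑ (C/q_g)² σ²
q_g = O(G_A / n)`. The least squares contrast is the inner product of the noise with a unit vector,
so it is exactly `N(0, σ²)`. Comparison of characteristic functions (`tendsto_charFun_of_close`)
gives the limit. -/

/-! ### The prior of the squared local parameter. -/

lemma PolynomialTail.measurable_weight {a : ℝ} {L : ℝ → ℝ} (hL : PolynomialTail a L) :
    Measurable fun t : ℝ => t ^ (-a - 1) * L t :=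
  (measurable_id.pow_const _).mul hL.measurable

lemma PolynomialTail.weight_pos {a : ℝ} {L : ℝ → ℝ} (hL : PolynomialTail a L) {t : ℝ} (ht : 0 < t) :
    0 < t ^ (-a - 1) * L t :=
  mul_pos (Real.rpow_pos_of_pos ht _) (hL.pos t ht)

lemma PolynomialTail.integral_weight_pos {a : ℝ} {L : ℝ → ℝ} (hL : PolynomialTail a L) :
    0 < ∫ t in Set.Ioi (0 : ℝ), t ^ (-a - 1) * L t := by
  rw [setIntegral_pos_iff_support_of_nonneg_ae]
  · have : Set.Ioi (0 : ℝ) ⊆ (Function.support fun t : ℝ => t ^ (-a - 1) * L t) ∩ Set.Ioi 0 :=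
      fun t ht => ⟨(hL.weight_pos ht).ne', ht⟩
    exact lt_of_lt_of_le (by simp) (measure_mono this)
  · filter_upwards [ae_restrict_mem measurableSet_Ioi] with t ht using (hL.weight_pos ht).le
  · exact hL.proper

lemma PolynomialTail.mass_eq {a : ℝ} {L : ℝ → ℝ} (hL : PolynomialTail a L) :
    ((volume.restrict (Set.Ioi (0 : ℝ))).withDensity
      fun t => ENNReal.ofReal (t ^ (-a - 1) * L t)) Set.univ =
      ENNReal.ofReal (∫ t in Set.Ioi (0 : ℝ), t ^ (-a - 1) * L t) := by
  rw [withDensity_apply _ MeasurableSet.univ, Measure.restrict_univ,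
    ofReal_integral_eq_lintegral_ofReal hL.proper]
  filter_upwards [ae_restrict_mem measurableSet_Ioi] with t ht using (hL.weight_pos ht).le

lemma PolynomialTail.isProbabilityMeasure {a : ℝ} {L : ℝ → ℝ} (hL : PolynomialTail a L) :
    IsProbabilityMeasure (localPrior a L) := by
  constructor
  simp only [localPrior, Measure.smul_apply, smul_eq_mul]
  rw [hL.mass_eq]
  exact ENNReal.inv_mul_cancel (by simpa using hL.integral_weight_pos) ENNReal.ofReal_ne_top

lemma PolynomialTail.integral_localPrior {a : ℝ} {L : ℝ → ℝ} (hL : PolynomialTail a L)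
    (f : ℝ → ℝ) :
    ∫ t, f t ∂(localPrior a L) =
      (∫ t in Set.Ioi (0 : ℝ), t ^ (-a - 1) * L t)⁻¹ *
        ∫ t in Set.Ioi (0 : ℝ), f t * (t ^ (-a - 1) * L t) := by
  simp only [localPrior]
  rw [integral_smul_measure, hL.mass_eq, ENNReal.toReal_inv,
    ENNReal.toReal_ofReal hL.integral_weight_pos.le,
    integral_withDensity_eq_integral_toReal_smul hL.measurable_weight.ennreal_ofReal
      (by simp), smul_eq_mul]
  congr 1
  refine setIntegral_congr_fun measurableSet_Ioi fun t ht => ?_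
  simp only [smul_eq_mul]
  rw [ENNReal.toReal_ofReal (hL.weight_pos ht).le, mul_comm]

lemma ae_localPrior_pos (a : ℝ) (L : ℝ → ℝ) : ∀ᵐ t ∂(localPrior a L), 0 < t := by
  simp only [localPrior]
  refine Measure.ae_smul_measure ?_ _
  exact (withDensity_absolutelyContinuous _ _).ae_le (ae_restrict_mem measurableSet_Ioi)

/-! ### Two-sided estimates of the shrinkage integrals. -/

/-- For an integer `k ≥ r` the power is at most `1 + x^k`, and one term of the series of `exp(x/2)`
controls `x^k`. -/
lemma exists_rpow_mul_exp_neg_half_le {r : ℝ} (hr : 0 ≤ r) :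
    ∃ B > 0, ∀ x : ℝ, 0 ≤ x → x ^ r * Real.exp (-x / 2) ≤ B := by
  obtain ⟨k, hk⟩ := exists_nat_ge r
  refine ⟨1 + 2 ^ k * k.factorial, by positivity, fun x hx => ?_⟩
  have h1 : x ^ r ≤ 1 + x ^ k := by
    rcases le_total x 1 with h | h
    · have := Real.rpow_le_one hx h hr
      have := pow_nonneg hx k
      linarith
    · have := Real.rpow_le_rpow_of_exponent_le h hk
      rw [Real.rpow_natCast] at this
      linarith
  have h2 : x ^ k ≤ 2 ^ k * k.factorial * Real.exp (x / 2) := by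
    have := Real.pow_div_factorial_le_exp (x / 2) (by positivity) k
    rw [div_le_iff₀ (by positivity), div_pow, div_le_iff₀ (by positivity)] at this
    linarith
  have h3 : Real.exp (-x / 2) ≤ 1 := Real.exp_le_one_iff.2 (by linarith)
  have h4 : Real.exp (x / 2) * Real.exp (-x / 2) = 1 := by
    rw [← Real.exp_add]; simp [neg_div]
  have h5 := Real.exp_pos (-x / 2)
  calc x ^ r * Real.exp (-x / 2)
      ≤ (1 + 2 ^ k * k.factorial * Real.exp (x / 2)) * Real.exp (-x / 2) := by gcongr; linarith
    _ = Real.exp (-x / 2) + 2 ^ k * k.factorial * (Real.exp (x / 2) * Real.exp (-x / 2)) := by ring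
    _ ≤ _ := by rw [h4]; linarith

/-- The shrinkage factor `κ = 1 / (1 + t τ²)` of a group with squared local parameter `t`. -/
noncomputable def shrinkFactor (τ t : ℝ) : ℝ := 1 / (1 + t * τ ^ 2)

lemma shrinkFactor_pos {τ t : ℝ} (ht : 0 < t) : 0 < shrinkFactor τ t := by
  unfold shrinkFactor; positivity

lemma shrinkFactor_le_one {τ t : ℝ} (ht : 0 < t) : shrinkFactor τ t ≤ 1 := by
  unfold shrinkFactor
  rw [div_le_one (by positivity)]
  have : 0 ≤ t * τ ^ 2 := by positivity
  linarith

lemma measurable_shrinkFactor (τ : ℝ) : Measurable (shrinkFactor τ) := by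
  unfold shrinkFactor; fun_prop

/-- The factor `κ ^ p exp (-κ q / 2)` of the posterior density of `λ²`. -/
noncomputable def shrinkKernel (p q τ t : ℝ) : ℝ :=
  shrinkFactor τ t ^ p * Real.exp (-(shrinkFactor τ t * q) / 2)

lemma measurable_shrinkKernel (p q τ : ℝ) : Measurable (shrinkKernel p q τ) := by
  have := measurable_shrinkFactor τ
  unfold shrinkKernel
  fun_prop

lemma shrinkKernel_nonneg {p q τ t : ℝ} (ht : 0 < t) : 0 ≤ shrinkKernel p q τ t := by
  have := shrinkFactor_pos (τ := τ) ht
  unfold shrinkKernel; positivity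

lemma shrinkKernel_le_one {p q τ t : ℝ} (hp : 0 ≤ p) (hq : 0 ≤ q) (ht : 0 < t) :
    shrinkKernel p q τ t ≤ 1 := by
  have h0 := shrinkFactor_pos (τ := τ) ht
  refine mul_le_one₀ (Real.rpow_le_one h0.le (shrinkFactor_le_one ht) hp) (by positivity) ?_
  refine Real.exp_le_one_iff.2 ?_
  have : 0 ≤ shrinkFactor τ t * q := by positivity
  linarith

/-- Bound for `κ ^ p exp (-κ q / 2) w(t)` by functions of `t` with explicit integrals. -/
lemma exists_shrinkKernel_mul_weight_le {a : ℝ} {L : ℝ → ℝ} (hL : PolynomialTail a L)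
    (hL' : TailBounds a L) {p : ℝ} (hp : 0 ≤ p) :
    ∃ D > 0, ∀ q τ t : ℝ, 1 ≤ q → 0 < τ → 0 < t →
      shrinkKernel p q τ t * (t ^ (-a - 1) * L t) ≤
        Real.exp (-q / 4) * (t ^ (-a - 1) * L t) +
        D * q ^ (-p) * ((Set.Ioc 0 (q / τ ^ 2)).indicator (fun _ => (q / τ ^ 2) ^ (-a - 1)) t +
          (Set.Ioi (q / τ ^ 2)).indicator (fun t => t ^ (-a - 1)) t) := by
  have ha := hL.a_pos
  obtain ⟨M, hM⟩ := hL'.upper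
  have hM0 : 0 < M := (hL.pos 1 one_pos).trans_le (hM 1 one_pos)
  -- The extra `a + 1` arises in the middle range of `t`, where `t^(-a-1)` is traded for `κ^(a+1)`.
  obtain ⟨B, hB0, hB⟩ := exists_rpow_mul_exp_neg_half_le (r := p + (a + 1)) (by linarith)
  refine ⟨max (M * 2 ^ (a + 1) * B) M, lt_max_of_lt_right hM0, fun q τ t hq hτ ht => ?_⟩
  set T := q / τ ^ 2 with hT
  have hT0 : 0 < T := by positivity
  have hq0 : 0 < q := by linarith
  have hw := (hL.weight_pos ht).le
  have hκ := shrinkFactor_pos (τ := τ) ht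
  have hκ1 := shrinkFactor_le_one (τ := τ) ht
  have hE : 0 ≤ Real.exp (-q / 4) * (t ^ (-a - 1) * L t) := by positivity
  -- Three ranges. If `t τ² ≤ 1`, then `κ ≥ 1/2` and the exponential is at most `exp(-q/4)`. If
  -- `1/τ² < t ≤ T`, then `1/t ≤ 2 τ² κ`, so the weight becomes a power of `κ` and the bound is
  -- constant in `t`. If `t > T`, then `κ ≤ 1/q` and the weight is kept.
  by_cases h1 : t ≤ T
  · have e1 : (Set.Ioc 0 T).indicator (fun _ => T ^ (-a - 1)) t = T ^ (-a - 1) :=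
      Set.indicator_of_mem (Set.mem_Ioc.2 ⟨ht, h1⟩) _
    have e2 : (Set.Ioi T).indicator (fun t => t ^ (-a - 1)) t = 0 :=
      Set.indicator_of_notMem (by simpa using h1) _
    rw [e1, e2, add_zero]
    by_cases h2 : t * τ ^ 2 ≤ 1
    · have hk : shrinkKernel p q τ t ≤ Real.exp (-q / 4) := by
        have hκ2 : 1 / 2 ≤ shrinkFactor τ t := by
          unfold shrinkFactor
          exact one_div_le_one_div_of_le (by positivity) (by linarith)
        unfold shrinkKernel
        calc _ ≤ 1 * Real.exp (-(shrinkFactor τ t * q) / 2) := by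
              gcongr
              exact Real.rpow_le_one hκ.le hκ1 hp
          _ ≤ _ := by
              rw [one_mul]
              apply Real.exp_le_exp.2
              nlinarith
      have : 0 ≤ max (M * 2 ^ (a + 1) * B) M * q ^ (-p) * T ^ (-a - 1) := by positivity
      have := mul_le_mul_of_nonneg_right hk hw
      linarith
    · push Not at h2
      have hinv : t⁻¹ ≤ 2 * τ ^ 2 * shrinkFactor τ t := by
        unfold shrinkFactor
        rw [mul_one_div, le_div_iff₀ (by positivity), inv_mul_le_iff₀ ht]
        nlinarith
      have hta : t ^ (-a - 1) ≤ (2 * τ ^ 2) ^ (a + 1) * shrinkFactor τ t ^ (a + 1) := by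
        rw [← Real.mul_rpow (by positivity) hκ.le, show -a - 1 = -(a + 1) by ring,
          Real.rpow_neg ht.le, ← Real.inv_rpow ht.le]
        exact Real.rpow_le_rpow (by positivity) hinv (by linarith)
      have hk : shrinkKernel p q τ t * shrinkFactor τ t ^ (a + 1) ≤ B * q ^ (-(p + (a + 1))) := by
        have h := hB (shrinkFactor τ t * q) (by positivity)
        rw [Real.mul_rpow hκ.le hq0.le] at h
        rw [Real.rpow_neg hq0.le, ← div_eq_mul_inv, le_div_iff₀ (by positivity)]
        refine le_trans (le_of_eq ?_) h
        unfold shrinkKernel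
        rw [Real.rpow_add hκ p]
        ring
      have hTq : (2 * τ ^ 2) ^ (a + 1) * q ^ (-(p + (a + 1))) =
          2 ^ (a + 1) * (q ^ (-p) * T ^ (-a - 1)) := by
        rw [Real.mul_rpow (by norm_num) (by positivity), hT, show -a - 1 = -(a + 1) by ring,
          Real.rpow_neg (x := q / τ ^ 2) (by positivity), Real.div_rpow hq0.le (by positivity),
          neg_add, Real.rpow_add hq0, Real.rpow_neg hq0.le (a + 1)]
        have : 0 < q ^ (a + 1) := by positivity
        have : 0 < (τ ^ 2) ^ (a + 1) := by positivity
        field_simp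
      have hkn := shrinkKernel_nonneg (p := p) (q := q) (τ := τ) ht
      calc shrinkKernel p q τ t * (t ^ (-a - 1) * L t)
          ≤ shrinkKernel p q τ t *
              (((2 * τ ^ 2) ^ (a + 1) * shrinkFactor τ t ^ (a + 1)) * M) := by
            gcongr
            · exact (hL.pos t ht).le
            · exact hM t ht
        _ = (shrinkKernel p q τ t * shrinkFactor τ t ^ (a + 1)) *
              ((2 * τ ^ 2) ^ (a + 1) * M) := by ring
        _ ≤ (B * q ^ (-(p + (a + 1)))) * ((2 * τ ^ 2) ^ (a + 1) * M) := by gcongr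
        _ = (M * B) * ((2 * τ ^ 2) ^ (a + 1) * q ^ (-(p + (a + 1)))) := by ring
        _ = (M * 2 ^ (a + 1) * B) * q ^ (-p) * T ^ (-a - 1) := by rw [hTq]; ring
        _ ≤ max (M * 2 ^ (a + 1) * B) M * q ^ (-p) * T ^ (-a - 1) := by
            gcongr
            exact le_max_left _ _
        _ ≤ _ := by linarith
  · push Not at h1
    have e1 : (Set.Ioc 0 T).indicator (fun _ => T ^ (-a - 1)) t = 0 :=
      Set.indicator_of_notMem (by simp [h1]) _
    have e2 : (Set.Ioi T).indicator (fun t => t ^ (-a - 1)) t = t ^ (-a - 1) :=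
      Set.indicator_of_mem h1 _
    rw [e1, e2, zero_add]
    have hκq : shrinkFactor τ t ≤ q⁻¹ := by
      unfold shrinkFactor
      rw [inv_eq_one_div]
      refine one_div_le_one_div_of_le hq0 ?_
      rw [hT, div_lt_iff₀ (by positivity)] at h1
      linarith
    have hk : shrinkKernel p q τ t ≤ q ^ (-p) := by
      unfold shrinkKernel
      have he : Real.exp (-(shrinkFactor τ t * q) / 2) ≤ 1 := by
        refine Real.exp_le_one_iff.2 ?_
        have : 0 ≤ shrinkFactor τ t * q := by positivity
        linarith
      calc _ ≤ (q⁻¹) ^ p * 1 := by gcongr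
        _ = _ := by rw [mul_one, Real.inv_rpow hq0.le, Real.rpow_neg hq0.le]
    calc shrinkKernel p q τ t * (t ^ (-a - 1) * L t) ≤ q ^ (-p) * (t ^ (-a - 1) * M) := by
          gcongr
          exact hM t ht
      _ = M * q ^ (-p) * t ^ (-a - 1) := by ring
      _ ≤ max (M * 2 ^ (a + 1) * B) M * q ^ (-p) * t ^ (-a - 1) := by
          gcongr
          exact le_max_right _ _
      _ ≤ _ := by linarith

lemma integrableOn_shrinkKernel_mul_weight {a : ℝ} {L : ℝ → ℝ} (hL : PolynomialTail a L)
    {p q : ℝ} (τ : ℝ) (hp : 0 ≤ p) (hq : 0 ≤ q) :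
    IntegrableOn (fun t => shrinkKernel p q τ t * (t ^ (-a - 1) * L t)) (Set.Ioi 0) := by
  refine Integrable.bdd_mul (c := 1) hL.proper
    (measurable_shrinkKernel p q τ).aestronglyMeasurable ?_
  filter_upwards [ae_restrict_mem measurableSet_Ioi] with t ht
  rw [Real.norm_of_nonneg (shrinkKernel_nonneg ht)]
  exact shrinkKernel_le_one hp hq ht

/-- Both the plateau on `(0, T]` and the tail beyond `T`, with `T = q/τ²`, integrate to multiples of
`T^(-a)`. -/
lemma exists_integral_shrinkKernel_le {a : ℝ} {L : ℝ → ℝ} (hL : PolynomialTail a L)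
    (hL' : TailBounds a L) {p : ℝ} (hp : 0 ≤ p) :
    ∃ D > 0, ∀ q τ : ℝ, 1 ≤ q → 0 < τ →
      ∫ t in Set.Ioi (0 : ℝ), shrinkKernel p q τ t * (t ^ (-a - 1) * L t) ≤
        D * (Real.exp (-q / 4) + q ^ (-p) * (q / τ ^ 2) ^ (-a)) := by
  have ha := hL.a_pos
  obtain ⟨D, hD, h⟩ := exists_shrinkKernel_mul_weight_le hL hL' hp
  set Z := ∫ t in Set.Ioi (0 : ℝ), t ^ (-a - 1) * L t with hZ
  refine ⟨max Z (D * (1 + 1 / a)), lt_max_of_lt_left hL.integral_weight_pos,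
    fun q τ hq hτ => ?_⟩
  have hq0 : 0 < q := by linarith
  set T := q / τ ^ 2 with hT
  have hT0 : 0 < T := by positivity
  have i1 : IntegrableOn ((Set.Ioc 0 T).indicator (fun _ => T ^ (-a - 1))) (Set.Ioi 0) := by
    refine ((integrable_indicator_iff measurableSet_Ioc).2 ?_).integrableOn
    exact integrableOn_const (by simp)
  have i2 : IntegrableOn ((Set.Ioi T).indicator (fun t : ℝ => t ^ (-a - 1))) (Set.Ioi 0) := by
    refine ((integrable_indicator_iff measurableSet_Ioi).2 ?_).integrableOn
    exact integrableOn_Ioi_rpow_of_lt (by linarith) hT0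
  have i12 : IntegrableOn (fun t => (Set.Ioc 0 T).indicator (fun _ => T ^ (-a - 1)) t +
      (Set.Ioi T).indicator (fun t : ℝ => t ^ (-a - 1)) t) (Set.Ioi 0) := i1.add i2
  have v1 : ∫ t in Set.Ioi 0, (Set.Ioc 0 T).indicator (fun _ => T ^ (-a - 1)) t = T ^ (-a) := by
    rw [setIntegral_indicator measurableSet_Ioc,
      show Set.Ioi (0 : ℝ) ∩ Set.Ioc 0 T = Set.Ioc 0 T from
        Set.inter_eq_right.2 fun t ht => ht.1, setIntegral_const]
    simp only [measureReal_def, Real.volume_Ioc, sub_zero, smul_eq_mul,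
      ENNReal.toReal_ofReal hT0.le]
    rw [Real.rpow_sub_one hT0.ne']
    field_simp
  have v2 : ∫ t in Set.Ioi 0, (Set.Ioi T).indicator (fun t => t ^ (-a - 1)) t =
      T ^ (-a) / a := by
    rw [setIntegral_indicator measurableSet_Ioi,
      show Set.Ioi (0 : ℝ) ∩ Set.Ioi T = Set.Ioi T from
        Set.inter_eq_right.2 fun t ht => hT0.trans ht,
      integral_Ioi_rpow_of_lt (by linarith) hT0]
    rw [show -a - 1 + 1 = -a by ring, neg_div_neg_eq]
  calc ∫ t in Set.Ioi (0 : ℝ), shrinkKernel p q τ t * (t ^ (-a - 1) * L t)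
      ≤ ∫ t in Set.Ioi (0 : ℝ), (Real.exp (-q / 4) * (t ^ (-a - 1) * L t) +
        D * q ^ (-p) * ((Set.Ioc 0 T).indicator (fun _ => T ^ (-a - 1)) t +
          (Set.Ioi T).indicator (fun t => t ^ (-a - 1)) t)) := by
        refine setIntegral_mono_on (integrableOn_shrinkKernel_mul_weight hL τ hp hq0.le)
          ((hL.proper.const_mul _).add (i12.const_mul _)) measurableSet_Ioi
          fun t ht => h q τ t hq hτ ht
    _ = Real.exp (-q / 4) * Z + D * q ^ (-p) * (T ^ (-a) + T ^ (-a) / a) := by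
        rw [integral_add (hL.proper.const_mul _) (i12.const_mul _), integral_const_mul,
          integral_const_mul, integral_add i1 i2, v1, v2]
    _ = Z * Real.exp (-q / 4) + D * (1 + 1 / a) * (q ^ (-p) * T ^ (-a)) := by ring
    _ ≤ max Z (D * (1 + 1 / a)) * Real.exp (-q / 4) +
        max Z (D * (1 + 1 / a)) * (q ^ (-p) * T ^ (-a)) := by
        gcongr
        · exact le_max_left _ _
        · exact le_max_right _ _
    _ = _ := by ring

/-- The window `(T, 2T]` with `T = q/τ²` already has the right order: there `1/(3q) ≤ κ ≤ 1/q`, so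
the exponential is bounded below. -/
lemma exists_le_integral_shrinkKernel {a : ℝ} {L : ℝ → ℝ} (hL : PolynomialTail a L)
    (hL' : TailBounds a L) {p : ℝ} (hp : 0 ≤ p) :
    ∃ c > 0, ∃ q₀ ≥ 1, ∀ q τ : ℝ, q₀ ≤ q → 0 < τ → τ ≤ 1 →
      c * (q ^ (-p) * (q / τ ^ 2) ^ (-a)) ≤
        ∫ t in Set.Ioi (0 : ℝ), shrinkKernel p q τ t * (t ^ (-a - 1) * L t) := by
  have ha := hL.a_pos
  obtain ⟨c₀, hc₀, t₀, -, hlow⟩ := hL'.lower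
  refine ⟨3 ^ (-p) * Real.exp (-1 / 2) * (2 ^ (-a - 1) * c₀), by positivity, max 1 t₀,
    le_max_left _ _, fun q τ hq hτ hτ1 => ?_⟩
  have hq1 : 1 ≤ q := (le_max_left _ _).trans hq
  have hqt : t₀ ≤ q := (le_max_right _ _).trans hq
  have hq0 : 0 < q := by linarith
  set T := q / τ ^ 2 with hT
  have hT0 : 0 < T := by positivity
  have hτ2 : τ ^ 2 ≤ 1 := pow_le_one₀ hτ.le hτ1
  -- This is where `τ ≤ 1` enters: it places the window beyond `t₀`, where `L` is bounded below.
  have hqT : q ≤ T := by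
    rw [hT, le_div_iff₀ (by positivity)]
    nlinarith
  have hTτ : T * τ ^ 2 = q := by rw [hT]; field_simp
  have hint := integrableOn_shrinkKernel_mul_weight hL τ hp hq0.le
  have hsub : Set.Ioc T (2 * T) ⊆ Set.Ioi 0 := fun t ht => hT0.trans ht.1
  have hpt : ∀ t ∈ Set.Ioc T (2 * T),
      (3 * q) ^ (-p) * Real.exp (-1 / 2) * ((2 * T) ^ (-a - 1) * c₀) ≤
        shrinkKernel p q τ t * (t ^ (-a - 1) * L t) := by
    rintro t ⟨h1, h2⟩
    have ht : 0 < t := hT0.trans h1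
    have hκ := shrinkFactor_pos (τ := τ) ht
    have u1 : q ≤ t * τ ^ 2 := by rw [← hTτ]; gcongr
    have u2 : t * τ ^ 2 ≤ 2 * q := by
      calc t * τ ^ 2 ≤ (2 * T) * τ ^ 2 := by gcongr
        _ = 2 * q := by rw [mul_assoc, hTτ]
    have k1 : (3 * q)⁻¹ ≤ shrinkFactor τ t := by
      unfold shrinkFactor
      rw [inv_eq_one_div]
      exact one_div_le_one_div_of_le (by positivity) (by linarith)
    have k2 : shrinkFactor τ t * q ≤ 1 := by
      unfold shrinkFactor
      rw [one_div, inv_mul_le_iff₀ (by positivity)]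
      linarith
    have hker : (3 * q) ^ (-p) * Real.exp (-1 / 2) ≤ shrinkKernel p q τ t := by
      unfold shrinkKernel
      rw [Real.rpow_neg (by positivity), ← Real.inv_rpow (by positivity)]
      gcongr
    have hwt : (2 * T) ^ (-a - 1) * c₀ ≤ t ^ (-a - 1) * L t := by
      have := hlow t (by linarith)
      have h3 : (2 * T) ^ (-a - 1) ≤ t ^ (-a - 1) :=
        Real.rpow_le_rpow_of_nonpos ht h2 (by linarith)
      gcongr
    gcongr
    exact shrinkKernel_nonneg ht
  calc _ = T * ((3 * q) ^ (-p) * Real.exp (-1 / 2) * ((2 * T) ^ (-a - 1) * c₀)) := by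
        rw [Real.mul_rpow (by norm_num) hq0.le, Real.mul_rpow (by norm_num) hT0.le,
          Real.rpow_sub_one hT0.ne']
        field_simp
    _ = ∫ t in Set.Ioc T (2 * T),
          (3 * q) ^ (-p) * Real.exp (-1 / 2) * ((2 * T) ^ (-a - 1) * c₀) := by
        rw [setIntegral_const]
        simp only [measureReal_def, Real.volume_Ioc, smul_eq_mul]
        rw [ENNReal.toReal_ofReal (by linarith)]
        ring
    _ ≤ ∫ t in Set.Ioc T (2 * T), shrinkKernel p q τ t * (t ^ (-a - 1) * L t) :=
        setIntegral_mono_on (integrableOn_const (by simp)) (hint.mono_set hsub)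
          measurableSet_Ioc hpt
    _ ≤ _ := by
        refine setIntegral_mono_set hint ?_ hsub.eventuallyLE
        filter_upwards [ae_restrict_mem measurableSet_Ioi] with t ht
        exact mul_nonneg (shrinkKernel_nonneg ht) (hL.weight_pos ht).le

/-- The posterior mean of `κ` is of order `1 / q`, uniformly in `τ ∈ [1 / (K q), 1]`. -/
lemma exists_integral_shrinkKernel_succ_le {a : ℝ} {L : ℝ → ℝ} (hL : PolynomialTail a L)
    (hL' : TailBounds a L) {p : ℝ} (hp : 0 ≤ p) {K : ℝ} (hK : 0 < K) :
    ∃ C > 0, ∃ q₀ ≥ 1, ∀ q τ : ℝ, q₀ ≤ q → 0 < τ → τ ≤ 1 → 1 / τ ≤ K * q →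
      ∫ t, shrinkKernel (p + 1) q τ t ∂(localPrior a L) ≤
        C / q * ∫ t, shrinkKernel p q τ t ∂(localPrior a L) := by
  have ha := hL.a_pos
  obtain ⟨D, hD, hup⟩ := exists_integral_shrinkKernel_le hL hL' (p := p + 1) (by linarith)
  obtain ⟨c, hc, q₀, hq₀, hlow⟩ := exists_le_integral_shrinkKernel hL hL' hp
  -- The exponent is that of `q^(p+1) T^a` once `T` is bounded by a multiple of `q³`.
  obtain ⟨B, hB0, hB⟩ := exists_rpow_mul_exp_neg_half_le (r := p + 1 + 3 * a) (by linarith)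
  set E := 2 ^ (p + 1 + 3 * a) * B * (K ^ 2) ^ a with hE
  have hE0 : 0 < E := by positivity
  refine ⟨D * (E + 1) / c, by positivity, q₀, hq₀, fun q τ hq hτ hτ1 hKq => ?_⟩
  have hq1 : 1 ≤ q := hq₀.le.trans hq
  have hq0 : 0 < q := by linarith
  rw [hL.integral_localPrior, hL.integral_localPrior, mul_left_comm]
  refine mul_le_mul_of_nonneg_left ?_ (inv_nonneg.2 hL.integral_weight_pos.le)
  refine (hup q τ hq1 hτ).trans ?_
  have hl := hlow q τ hq hτ hτ1
  set T := q / τ ^ 2 with hT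
  have hT0 : 0 < T := by positivity
  -- The lower bound on `τ` makes `T` polynomial in `q`, so that `exp(-q/4)` is absorbed by the main
  -- term.
  have hTle : T ≤ K ^ 2 * q ^ 3 := by
    have : (1 / τ) ^ 2 ≤ (K * q) ^ 2 := by gcongr
    calc T = q * (1 / τ) ^ 2 := by rw [hT]; ring
      _ ≤ q * (K * q) ^ 2 := by gcongr
      _ = _ := by ring
  have hTa : T ^ a ≤ (K ^ 2) ^ a * q ^ (3 * a) := by
    calc T ^ a ≤ (K ^ 2 * q ^ 3) ^ a := by gcongr
      _ = _ := by
        rw [Real.mul_rpow (by positivity) (by positivity), Real.rpow_mul hq0.le]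
        norm_num
  have hexp : Real.exp (-q / 4) ≤ E * (q ^ (-(p + 1)) * T ^ (-a)) := by
    have h1 := hB (q / 2) (by positivity)
    rw [Real.div_rpow hq0.le (by norm_num), div_mul_eq_mul_div, div_le_iff₀ (by positivity),
      show -(q / 2) / 2 = -q / 4 by ring, Real.rpow_add hq0 (p + 1)] at h1
    rw [Real.rpow_neg hq0.le, Real.rpow_neg hT0.le, ← mul_inv, ← div_eq_mul_inv,
      le_div_iff₀ (by positivity)]
    calc Real.exp (-q / 4) * (q ^ (p + 1) * T ^ a)
        ≤ Real.exp (-q / 4) * (q ^ (p + 1) * ((K ^ 2) ^ a * q ^ (3 * a))) := by gcongr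
      _ = (K ^ 2) ^ a * (q ^ (p + 1) * q ^ (3 * a) * Real.exp (-q / 4)) := by ring
      _ ≤ (K ^ 2) ^ a * (B * 2 ^ (p + 1 + 3 * a)) := by gcongr
      _ = E := by rw [hE]; ring
  calc D * (Real.exp (-q / 4) + q ^ (-(p + 1)) * T ^ (-a))
      ≤ D * (E * (q ^ (-(p + 1)) * T ^ (-a)) + q ^ (-(p + 1)) * T ^ (-a)) := by gcongr
    _ = D * (E + 1) / c / q * (c * (q ^ (-p) * T ^ (-a))) := by
        rw [neg_add, Real.rpow_add hq0, Real.rpow_neg_one]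
        field_simp
    _ ≤ _ := by gcongr

/-! ### Exponentially tilted Gaussian integrals. -/

/-- Completing the square: the tilted standard normal density is a constant times another normal
density. -/
lemma integral_exp_quadratic_mul_gaussianReal (c : ℝ) {d : ℝ} (hd : 0 < d) (f : ℝ → ℝ) :
    ∫ x, Real.exp (c * x - d / 2 * x ^ 2) * f x ∂(gaussianReal 0 1) =
      (√(1 + d))⁻¹ * Real.exp (c ^ 2 / (2 * (1 + d))) *
        ∫ x, f x ∂(gaussianReal (c / (1 + d)) (1 + d)⁻¹.toNNReal) := by
  have hv : (1 + d)⁻¹.toNNReal ≠ 0 := by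
    rw [ne_eq, Real.toNNReal_eq_zero, not_le]; positivity
  rw [integral_gaussianReal_eq_integral_smul one_ne_zero,
    integral_gaussianReal_eq_integral_smul hv, ← integral_const_mul]
  congr 1 with x
  have hs : √(2 * Real.pi * (1 + d)⁻¹) = √(2 * Real.pi) * (√(1 + d))⁻¹ := by
    rw [Real.sqrt_mul (by positivity), Real.sqrt_inv]
  have hpi : √(2 * Real.pi) ≠ 0 := by positivity
  have hsd : √(1 + d) ≠ 0 := by positivity
  simp only [gaussianPDFReal, smul_eq_mul, NNReal.coe_one, mul_one, sub_zero,
    Real.coe_toNNReal _ (inv_nonneg.2 (by positivity : (0 : ℝ) ≤ 1 + d)), hs]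
  have he : Real.exp (-x ^ 2 / 2) * Real.exp (c * x - d / 2 * x ^ 2) =
      Real.exp (c ^ 2 / (2 * (1 + d))) * Real.exp (-(x - c / (1 + d)) ^ 2 / (2 * (1 + d)⁻¹)) := by
    rw [← Real.exp_add, ← Real.exp_add]
    congr 1
    field_simp
    ring
  rw [mul_inv, inv_inv]
  calc _ = (√(2 * Real.pi))⁻¹ * (Real.exp (-x ^ 2 / 2) * Real.exp (c * x - d / 2 * x ^ 2)) * f x := by
        ring
    _ = _ := by
        rw [he]; field_simp

lemma integral_exp_quadratic_gaussianReal (c : ℝ) {d : ℝ} (hd : 0 < d) :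
    ∫ x, Real.exp (c * x - d / 2 * x ^ 2) ∂(gaussianReal 0 1) =
      (√(1 + d))⁻¹ * Real.exp (c ^ 2 / (2 * (1 + d))) := by
  simpa using integral_exp_quadratic_mul_gaussianReal c hd fun _ => 1

lemma integral_exp_quadratic_mul_id_gaussianReal (c : ℝ) {d : ℝ} (hd : 0 < d) :
    ∫ x, Real.exp (c * x - d / 2 * x ^ 2) * x ∂(gaussianReal 0 1) =
      c / (1 + d) * ∫ x, Real.exp (c * x - d / 2 * x ^ 2) ∂(gaussianReal 0 1) := by
  rw [integral_exp_quadratic_mul_gaussianReal c hd, integral_exp_quadratic_gaussianReal c hd,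
    integral_id_gaussianReal, mul_comm]

/-- By Fubini, an extra function of one coordinate changes only the factor of that coordinate. This
serves both for the coefficients and for the local parameters. -/
lemma MeasureTheory.integral_pi_prod_mul_eval {ι : Type*} [Fintype ι] {E : ι → Type*}
    {mE : ∀ i, MeasurableSpace (E i)} {μ : (i : ι) → Measure (E i)} [∀ i, SigmaFinite (μ i)]
    (f : (i : ι) → E i → ℝ) (g : ι) (ψ : E g → ℝ) {r : ℝ}
    (h : ∫ x, f g x * ψ x ∂(μ g) = r * ∫ x, f g x ∂(μ g)) :
    ∫ x, (∏ i, f i (x i)) * ψ (x g) ∂(Measure.pi μ) = r * ∏ i, ∫ x, f i x ∂(μ i) := by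
  classical
  set F := Function.update f g fun x => f g x * ψ x with hF
  have hFg : F g = fun x => f g x * ψ x := Function.update_self ..
  have hFn : ∀ i ≠ g, F i = f i := fun i hi => Function.update_of_ne hi _ _
  have e1 : ∀ x : (i : ι) → E i, (∏ i, f i (x i)) * ψ (x g) = ∏ i, F i (x i) := fun x => by
    have : ∏ i ∈ Finset.univ.erase g, F i (x i) = ∏ i ∈ Finset.univ.erase g, f i (x i) :=
      Finset.prod_congr rfl fun i hi => by rw [hFn i (Finset.ne_of_mem_erase hi)]
    rw [← Finset.mul_prod_erase _ _ (Finset.mem_univ g),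
      ← Finset.mul_prod_erase _ (fun i => F i (x i)) (Finset.mem_univ g), this, hFg]
    ring
  have e2 : ∏ i ∈ Finset.univ.erase g, ∫ x, F i x ∂(μ i) =
      ∏ i ∈ Finset.univ.erase g, ∫ x, f i x ∂(μ i) :=
    Finset.prod_congr rfl fun i hi => by rw [hFn i (Finset.ne_of_mem_erase hi)]
  simp_rw [e1]
  rw [integral_fintype_prod_eq_prod, ← Finset.mul_prod_erase _ _ (Finset.mem_univ g),
    ← Finset.mul_prod_erase _ (fun i => ∫ x, f i x ∂(μ i)) (Finset.mem_univ g), e2, hFg, h]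
  ring

lemma integral_euclidean_apply {ι Ω : Type*} [Fintype ι] {mΩ : MeasurableSpace Ω}
    {μ : Measure Ω} {f : Ω → EuclideanSpace ℝ ι} (hf : Integrable f μ) (k : ι) :
    (∫ x, f x ∂μ) k = ∫ x, f x k ∂μ :=
  ((EuclideanSpace.proj (𝕜 := ℝ) k).integral_comp_comm hf).symm

section StdGaussian

variable {ι : Type*} [Fintype ι]

lemma exp_quadratic_eq_prod (w z : EuclideanSpace ℝ ι) (d : ℝ) :
    Real.exp (inner ℝ w z - d / 2 * ‖z‖ ^ 2) =
      ∏ i, Real.exp (w i * z i - d / 2 * z i ^ 2) := by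
  rw [← Real.exp_sum, EuclideanSpace.real_norm_sq_eq, PiLp.inner_apply, Finset.mul_sum,
    ← Finset.sum_sub_distrib]
  simp [mul_comm]

/-- The tilt is bounded in `z`, so integrability against it is inherited from the Gaussian measure.
-/
lemma exp_quadratic_le (w z : EuclideanSpace ℝ ι) {d : ℝ} (hd : 0 < d) :
    Real.exp (inner ℝ w z - d / 2 * ‖z‖ ^ 2) ≤ Real.exp (‖w‖ ^ 2 / (2 * d)) := by
  apply Real.exp_le_exp.2
  have h1 := real_inner_le_norm w z
  have h2 : 0 ≤ (‖w‖ - d * ‖z‖) ^ 2 / (2 * d) := by positivity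
  have h3 : (‖w‖ - d * ‖z‖) ^ 2 / (2 * d) =
      ‖w‖ ^ 2 / (2 * d) - ‖w‖ * ‖z‖ + d / 2 * ‖z‖ ^ 2 := by
    field_simp
    ring
  linarith

lemma integral_exp_quadratic_stdGaussian (w : EuclideanSpace ℝ ι) {d : ℝ} (hd : 0 < d) :
    ∫ z, Real.exp (inner ℝ w z - d / 2 * ‖z‖ ^ 2) ∂(stdGaussian (EuclideanSpace ℝ ι)) =
      (√(1 + d))⁻¹ ^ Fintype.card ι * Real.exp (‖w‖ ^ 2 / (2 * (1 + d))) := by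
  simp_rw [exp_quadratic_eq_prod]
  rw [← map_pi_eq_stdGaussian, integral_map (by fun_prop) (by fun_prop)]
  rw [integral_fintype_prod_eq_prod (f := fun i x => Real.exp (w i * x - d / 2 * x ^ 2))]
  simp_rw [integral_exp_quadratic_gaussianReal _ hd]
  rw [Finset.prod_mul_distrib, Finset.prod_const, Finset.card_univ, ← Real.exp_sum,
    EuclideanSpace.real_norm_sq_eq, Finset.sum_div]

lemma integrable_exp_quadratic_smul_stdGaussian (w : EuclideanSpace ℝ ι) {d : ℝ} (hd : 0 < d) :
    Integrable (fun z => Real.exp (inner ℝ w z - d / 2 * ‖z‖ ^ 2) • z)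
      (stdGaussian (EuclideanSpace ℝ ι)) := by
  refine Integrable.bdd_smul (IsGaussian.integrable_id (μ := stdGaussian (EuclideanSpace ℝ ι)))
    (C := Real.exp (‖w‖ ^ 2 / (2 * d)))
    (φ := fun z => Real.exp (inner ℝ w z - d / 2 * ‖z‖ ^ 2)) (by fun_prop) ?_
  refine ae_of_all _ fun z => ?_
  rw [Real.norm_of_nonneg (Real.exp_pos _).le]
  exact exp_quadratic_le w z hd

lemma integral_exp_quadratic_smul_stdGaussian (w : EuclideanSpace ℝ ι) {d : ℝ} (hd : 0 < d) :
    ∫ z, Real.exp (inner ℝ w z - d / 2 * ‖z‖ ^ 2) • z ∂(stdGaussian (EuclideanSpace ℝ ι)) =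
      ((∫ z, Real.exp (inner ℝ w z - d / 2 * ‖z‖ ^ 2) ∂(stdGaussian (EuclideanSpace ℝ ι))) *
        (1 + d)⁻¹) • w := by
  ext k
  rw [integral_euclidean_apply (integrable_exp_quadratic_smul_stdGaussian w hd)]
  simp only [PiLp.smul_apply, smul_eq_mul]
  simp_rw [exp_quadratic_eq_prod]
  rw [← map_pi_eq_stdGaussian, integral_map (by fun_prop) (by fun_prop),
    integral_map (by fun_prop) (by fun_prop)]
  rw [integral_pi_prod_mul_eval (fun i x => Real.exp (w i * x - d / 2 * x ^ 2)) k (fun x => x)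
      (integral_exp_quadratic_mul_id_gaussianReal (w k) hd),
    integral_fintype_prod_eq_prod (f := fun i x => Real.exp (w i * x - d / 2 * x ^ 2))]
  ring

end StdGaussian

/-! ### Conjugacy within one group. -/

section Posterior

variable {ι : Type*} [Fintype ι]

/-- The factor of the Gaussian likelihood of `b` in a linear model with Gram matrix `S`, error
variance `ρ` and `r = Xᵀ y`. -/
noncomputable def groupLikelihood (S : Matrix ι ι ℝ) (ρ : ℝ) (r : ι → ℝ)
    (b : EuclideanSpace ℝ ι) : ℝ :=
  Real.exp ((2 * (r ⬝ᵥ b) - b ⬝ᵥ (S *ᵥ b)) / (2 * ρ))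

lemma continuous_groupLikelihood (S : Matrix ι ι ℝ) (ρ : ℝ) (r : ι → ℝ) :
    Continuous (groupLikelihood S ρ r) := by
  unfold groupLikelihood
  simp only [dotProduct, mulVec]
  fun_prop

variable [DecidableEq ι]

/-- With `T² = c S⁻¹`, the matrix `c⁻¹ T` is a left inverse of `T S`, hence also a right inverse. -/
lemma Matrix.PosDef.sqrt_smul_inv_conj {S : Matrix ι ι ℝ} (hS : S.PosDef) {c : ℝ} (hc : 0 < c) :
    CFC.sqrt (c • S⁻¹) * S * CFC.sqrt (c • S⁻¹) = c • 1 := by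
  have hps : (c • S⁻¹).PosSemidef := hS.inv.posSemidef.smul hc.le
  have hTT := CFC.sqrt_mul_sqrt_self (c • S⁻¹) hps.nonneg
  set T := CFC.sqrt (c • S⁻¹)
  have hu : IsUnit S.det := (Matrix.isUnit_iff_isUnit_det _).1 hS.isUnit
  have h1 : (c⁻¹ • T) * (T * S) = 1 := by
    rw [Matrix.smul_mul, ← Matrix.mul_assoc, hTT, Matrix.smul_mul, Matrix.nonsing_inv_mul _ hu,
      smul_smul, inv_mul_cancel₀ hc.ne', one_smul]
  have h2 := mul_eq_one_comm.1 h1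
  rw [Matrix.mul_smul] at h2
  rw [← h2, smul_smul, mul_inv_cancel₀ hc.ne', one_smul]

lemma Matrix.transpose_sqrt (A : Matrix ι ι ℝ) : (CFC.sqrt A)ᵀ = CFC.sqrt A := by
  have h : IsSelfAdjoint (CFC.sqrt A) := (CFC.sqrt_nonneg A).isSelfAdjoint
  rw [← Matrix.conjTranspose_eq_transpose_of_trivial]
  exact h

/-- Whitening: in coordinates where the prior is standard Gaussian, the quadratic part of the
likelihood is isotropic. -/
lemma groupLikelihood_sqrt_mulVec {S : Matrix ι ι ℝ} (hS : S.PosDef) {u ρ : ℝ} (hu : 0 < u)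
    (hρ : 0 < ρ) (r : ι → ℝ) (z : EuclideanSpace ℝ ι) :
    groupLikelihood S ρ r (toEuclideanCLM (𝕜 := ℝ) (CFC.sqrt ((u * ρ) • S⁻¹)) z) =
      Real.exp (inner ℝ (WithLp.toLp 2 (ρ⁻¹ • (CFC.sqrt ((u * ρ) • S⁻¹) *ᵥ r))) z -
        u / 2 * ‖z‖ ^ 2) := by
  have hconj := hS.sqrt_smul_inv_conj (mul_pos hu hρ)
  have hT := Matrix.transpose_sqrt ((u * ρ) • S⁻¹)
  set T := CFC.sqrt ((u * ρ) • S⁻¹)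
  unfold groupLikelihood
  congr 1
  have e1 : r ⬝ᵥ (T *ᵥ z) = (T *ᵥ r) ⬝ᵥ z := by
    rw [Matrix.dotProduct_mulVec, ← Matrix.mulVec_transpose, hT]
  have e2 : (T *ᵥ z) ⬝ᵥ (S *ᵥ (T *ᵥ z)) = (u * ρ) * ‖z‖ ^ 2 := by
    rw [dotProduct_comm, Matrix.dotProduct_mulVec, ← Matrix.mulVec_transpose, hT,
      Matrix.mulVec_mulVec, Matrix.mulVec_mulVec, hconj, Matrix.smul_mulVec,
      Matrix.one_mulVec, smul_dotProduct, smul_eq_mul, EuclideanSpace.real_norm_sq_eq]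
    simp [dotProduct, pow_two]
  have e3 : inner ℝ (WithLp.toLp 2 (ρ⁻¹ • (T *ᵥ r)) : EuclideanSpace ℝ ι) z =
      ρ⁻¹ * ((T *ᵥ r) ⬝ᵥ z) := by
    rw [← smul_eq_mul, ← smul_dotProduct, PiLp.inner_apply]
    simp [dotProduct, mul_comm]
  rw [Matrix.ofLp_toEuclideanCLM, e1, e2, e3]
  field_simp

lemma norm_sq_sqrt_mulVec {S : Matrix ι ι ℝ} (hS : S.PosDef) {u ρ : ℝ} (hu : 0 < u)
    (hρ : 0 < ρ) (r : ι → ℝ) :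
    ‖(WithLp.toLp 2 (ρ⁻¹ • (CFC.sqrt ((u * ρ) • S⁻¹) *ᵥ r)) : EuclideanSpace ℝ ι)‖ ^ 2 =
      u * (r ⬝ᵥ (S⁻¹ *ᵥ r) / ρ) := by
  have hps : ((u * ρ) • S⁻¹).PosSemidef := hS.inv.posSemidef.smul (mul_pos hu hρ).le
  have hTT := CFC.sqrt_mul_sqrt_self ((u * ρ) • S⁻¹) hps.nonneg
  have hT := Matrix.transpose_sqrt ((u * ρ) • S⁻¹)
  set T := CFC.sqrt ((u * ρ) • S⁻¹)
  have e1 : (T *ᵥ r) ⬝ᵥ (T *ᵥ r) = (u * ρ) * (r ⬝ᵥ (S⁻¹ *ᵥ r)) := by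
    rw [Matrix.dotProduct_mulVec, ← Matrix.mulVec_transpose, hT, Matrix.mulVec_mulVec, hTT,
      Matrix.smul_mulVec, smul_dotProduct, smul_eq_mul, dotProduct_comm]
  have e2 : ‖(WithLp.toLp 2 (ρ⁻¹ • (T *ᵥ r)) : EuclideanSpace ℝ ι)‖ ^ 2 =
      ρ⁻¹ * (ρ⁻¹ * ((T *ᵥ r) ⬝ᵥ (T *ᵥ r))) := by
    rw [EuclideanSpace.real_norm_sq_eq]
    simp only [Pi.smul_apply, smul_eq_mul, dotProduct, Finset.mul_sum]
    exact Finset.sum_congr rfl fun i _ => by ring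
  rw [e2, e1]
  field_simp

/-- With `u = t τ²`, the whitened integral is `(1+u)^(-m/2) exp(u q / (2(1+u)))`, and `u/(1+u) = 1 -
κ`. The factor `exp(q/2)` is free of `t` and cancels in the posterior. -/
lemma integral_groupLikelihood {S : Matrix ι ι ℝ} (hS : S.PosDef) {t τ σ : ℝ} (ht : 0 < t)
    (hτ : 0 < τ) (hσ : 0 < σ) (r : ι → ℝ) :
    ∫ b, groupLikelihood S (σ ^ 2) r b ∂(multivariateGaussian 0 ((t * σ ^ 2 * τ ^ 2) • S⁻¹)) =
      Real.exp (r ⬝ᵥ (S⁻¹ *ᵥ r) / σ ^ 2 / 2) *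
        shrinkKernel (Fintype.card ι / 2) (r ⬝ᵥ (S⁻¹ *ᵥ r) / σ ^ 2) τ t := by
  have hu : 0 < t * τ ^ 2 := by positivity
  have hρ : 0 < σ ^ 2 := by positivity
  rw [show t * σ ^ 2 * τ ^ 2 = t * τ ^ 2 * σ ^ 2 by ring, multivariateGaussian,
    integral_map (by fun_prop) (continuous_groupLikelihood S _ r).aestronglyMeasurable]
  simp_rw [zero_add, groupLikelihood_sqrt_mulVec hS hu hρ]
  rw [integral_exp_quadratic_stdGaussian _ hu, norm_sq_sqrt_mulVec hS hu hρ]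
  have hs : (√(1 + t * τ ^ 2))⁻¹ ^ Fintype.card ι =
      shrinkFactor τ t ^ ((Fintype.card ι : ℝ) / 2) := by
    unfold shrinkFactor
    rw [one_div, ← Real.sqrt_inv, Real.sqrt_eq_rpow, ← Real.rpow_natCast, ← Real.rpow_mul
      (by positivity)]
    congr 1
    ring
  rw [hs, shrinkKernel, mul_left_comm, ← Real.exp_add]
  congr 2
  generalize r ⬝ᵥ (S⁻¹ *ᵥ r) = Q
  unfold shrinkFactor
  field_simp
  ring

lemma integrable_groupLikelihood_smul {S : Matrix ι ι ℝ} (hS : S.PosDef) {t τ σ : ℝ} (ht : 0 < t)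
    (hτ : 0 < τ) (hσ : 0 < σ) (r : ι → ℝ) :
    Integrable (fun b => groupLikelihood S (σ ^ 2) r b • b)
      (multivariateGaussian 0 ((t * σ ^ 2 * τ ^ 2) • S⁻¹)) := by
  have hu : 0 < t * τ ^ 2 := by positivity
  have hρ : 0 < σ ^ 2 := by positivity
  have hcont := continuous_groupLikelihood S (σ ^ 2) r
  rw [show t * σ ^ 2 * τ ^ 2 = t * τ ^ 2 * σ ^ 2 by ring, multivariateGaussian,
    integrable_map_measure
      (by fun_prop : Continuous fun b => groupLikelihood S (σ ^ 2) r b • b).aestronglyMeasurable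
      (by fun_prop)]
  simp_rw [Function.comp_def, zero_add, groupLikelihood_sqrt_mulVec hS hu hρ, ← map_smul]
  exact ContinuousLinearMap.integrable_comp _ (integrable_exp_quadratic_smul_stdGaussian _ hu)

/-- The tilted Gaussian has mean `w/(1+u)`, and mapping back by `T` turns it into `u/(1+u) = 1 - κ`
times the least squares vector. -/
lemma integral_groupLikelihood_smul {S : Matrix ι ι ℝ} (hS : S.PosDef) {t τ σ : ℝ} (ht : 0 < t)
    (hτ : 0 < τ) (hσ : 0 < σ) (r : ι → ℝ) :
    ∫ b, groupLikelihood S (σ ^ 2) r b • b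
        ∂(multivariateGaussian 0 ((t * σ ^ 2 * τ ^ 2) • S⁻¹)) =
      ((1 - shrinkFactor τ t) * ∫ b, groupLikelihood S (σ ^ 2) r b
        ∂(multivariateGaussian 0 ((t * σ ^ 2 * τ ^ 2) • S⁻¹))) • WithLp.toLp 2 (S⁻¹ *ᵥ r) := by
  have hu : 0 < t * τ ^ 2 := by positivity
  have hρ : 0 < σ ^ 2 := by positivity
  have hcont := continuous_groupLikelihood S (σ ^ 2) r
  rw [show t * σ ^ 2 * τ ^ 2 = t * τ ^ 2 * σ ^ 2 by ring, multivariateGaussian,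
    integral_map (by fun_prop) hcont.aestronglyMeasurable,
    integral_map (by fun_prop) (by fun_prop : Continuous fun b => groupLikelihood S (σ ^ 2) r b • b).aestronglyMeasurable]
  simp_rw [zero_add, groupLikelihood_sqrt_mulVec hS hu hρ, ← map_smul]
  have hps : ((t * τ ^ 2 * σ ^ 2) • S⁻¹).PosSemidef :=
    hS.inv.posSemidef.smul (mul_pos hu hρ).le
  have hTT := CFC.sqrt_mul_sqrt_self ((t * τ ^ 2 * σ ^ 2) • S⁻¹) hps.nonneg
  set T := CFC.sqrt ((t * τ ^ 2 * σ ^ 2) • S⁻¹)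
  set w : EuclideanSpace ℝ ι := WithLp.toLp 2 ((σ ^ 2)⁻¹ • (T *ᵥ r)) with hw
  rw [ContinuousLinearMap.integral_comp_comm _ (integrable_exp_quadratic_smul_stdGaussian w hu),
    integral_exp_quadratic_smul_stdGaussian w hu, map_smul]
  have hTw : toEuclideanCLM (𝕜 := ℝ) T w =
      (t * τ ^ 2) • (WithLp.toLp 2 (S⁻¹ *ᵥ r) : EuclideanSpace ℝ ι) := by
    rw [hw, Matrix.toEuclideanCLM_toLp, Matrix.mulVec_smul, Matrix.mulVec_mulVec, hTT,
      Matrix.smul_mulVec, smul_smul, ← WithLp.toLp_smul]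
    congr 2
    field_simp
  have hκ : (1 + t * τ ^ 2)⁻¹ * (t * τ ^ 2) = 1 - shrinkFactor τ t := by
    unfold shrinkFactor
    field_simp
    ring
  rw [hTw, smul_smul, mul_assoc, hκ, mul_comm]

end Posterior

/-! ### The posterior under a block orthogonal design. -/

/-- The posterior mean of `κ` in a group with `2 p` regressors, as a function of the
standardised squared projection `q` of the response and of `τ`. -/
noncomputable def shrinkMean (a : ℝ) (L : ℝ → ℝ) (p q τ : ℝ) : ℝ :=
  (∫ t, shrinkKernel (p + 1) q τ t ∂(localPrior a L)) /
    ∫ t, shrinkKernel p q τ t ∂(localPrior a L)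

lemma shrinkKernel_add_one {p q τ t : ℝ} (ht : 0 < t) :
    shrinkKernel (p + 1) q τ t = shrinkKernel p q τ t * shrinkFactor τ t := by
  unfold shrinkKernel
  rw [Real.rpow_add_one (shrinkFactor_pos ht).ne']
  ring

lemma integrable_shrinkKernel {a : ℝ} {L : ℝ → ℝ} (hL : PolynomialTail a L)
    {p q : ℝ} (τ : ℝ) (hp : 0 ≤ p) (hq : 0 ≤ q) :
    Integrable (shrinkKernel p q τ) (localPrior a L) := by
  have := hL.isProbabilityMeasure
  refine Integrable.of_bound (measurable_shrinkKernel p q τ).aestronglyMeasurable 1 ?_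
  filter_upwards [ae_localPrior_pos a L] with t ht
  rw [Real.norm_of_nonneg (shrinkKernel_nonneg ht)]
  exact shrinkKernel_le_one hp hq ht

lemma integral_shrinkKernel_pos {a : ℝ} {L : ℝ → ℝ} (hL : PolynomialTail a L)
    {p q : ℝ} (τ : ℝ) (hp : 0 ≤ p) (hq : 0 ≤ q) :
    0 < ∫ t, shrinkKernel p q τ t ∂(localPrior a L) := by
  have := hL.isProbabilityMeasure
  have hpos : ∀ᵐ t ∂(localPrior a L), 0 < shrinkKernel p q τ t := by
    filter_upwards [ae_localPrior_pos a L] with t ht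
    have := shrinkFactor_pos (τ := τ) ht
    unfold shrinkKernel
    positivity
  refine (integral_nonneg_of_ae (hpos.mono fun t ht => ht.le)).lt_of_ne' fun h0 => ?_
  rw [integral_eq_zero_iff_of_nonneg_ae (hpos.mono fun t ht => ht.le)
    (integrable_shrinkKernel hL τ hp hq)] at h0
  obtain ⟨t, h1, h2⟩ := (h0.and hpos).exists
  exact h2.ne' h1

namespace GroupedDesign

variable {n : ℕ} (D : GroupedDesign n)

/-- `X_gᵀ y`. -/
def score (y : EuclideanSpace ℝ (Fin n)) (g : Fin D.numGroups) : Fin (D.size g) → ℝ :=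
  (D.block g)ᵀ *ᵥ y

/-- The squared norm of the projection of `y` onto the range of `X_g`. -/
noncomputable def projSq (y : EuclideanSpace ℝ (Fin n)) (g : Fin D.numGroups) : ℝ :=
  D.score y g ⬝ᵥ ((D.gram g)⁻¹ *ᵥ D.score y g)

variable {D}

lemma inner_block (y : EuclideanSpace ℝ (Fin n)) (g : Fin D.numGroups)
    (b : EuclideanSpace ℝ (Fin (D.size g))) :
    inner ℝ y (WithLp.toLp 2 (D.block g *ᵥ b)) = D.score y g ⬝ᵥ b := by
  rw [score, Matrix.mulVec_transpose, ← Matrix.dotProduct_mulVec, PiLp.inner_apply]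
  simp [dotProduct, mul_comm]

lemma inner_block_block (hD : D.BlockOrthogonal) (β : D.Coef) (γ : D.Coef)
    (g h : Fin D.numGroups) :
    inner ℝ (WithLp.toLp 2 (D.block g *ᵥ β g) : EuclideanSpace ℝ (Fin n))
      (WithLp.toLp 2 (D.block h *ᵥ γ h)) = if g = h then β h ⬝ᵥ (D.gram h *ᵥ γ h) else 0 := by
  rw [inner_block, score, Matrix.mulVec_mulVec]
  split_ifs with hgh
  · subst hgh
    rw [← gram, Matrix.dotProduct_mulVec, ← Matrix.mulVec_transpose]
    simp [gram, Matrix.transpose_mul]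
  · rw [hD h g (Ne.symm hgh)]
    simp

lemma norm_mean_sq (hD : D.BlockOrthogonal) (β : D.Coef) :
    ‖D.mean β‖ ^ 2 = ∑ g, β g ⬝ᵥ (D.gram g *ᵥ β g) := by
  rw [← real_inner_self_eq_norm_sq, mean, sum_inner]
  refine Finset.sum_congr rfl fun g _ => ?_
  rw [inner_sum]
  simp_rw [inner_block_block hD]
  simp

lemma norm_sub_mean_sq (hD : D.BlockOrthogonal) (y : EuclideanSpace ℝ (Fin n)) (β : D.Coef) :
    ‖y - D.mean β‖ ^ 2 =
      ‖y‖ ^ 2 - ∑ g, (2 * (D.score y g ⬝ᵥ β g) - β g ⬝ᵥ (D.gram g *ᵥ β g)) := by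
  rw [norm_sub_sq_real, norm_mean_sq hD, mean, inner_sum, Finset.sum_sub_distrib,
    Finset.mul_sum]
  simp_rw [inner_block]
  ring

/-- The factor of the likelihood that does not depend on the coefficients. -/
noncomputable def likelihoodConst (σ : ℝ) (y : EuclideanSpace ℝ (Fin n)) : ℝ :=
  (2 * Real.pi * σ ^ 2) ^ (-(n : ℝ) / 2) * Real.exp (-‖y‖ ^ 2 / (2 * σ ^ 2))

lemma likelihoodConst_pos {σ : ℝ} (hσ : 0 < σ) (y : EuclideanSpace ℝ (Fin n)) :
    0 < likelihoodConst σ y := by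
  unfold likelihoodConst
  have := Real.pi_pos
  positivity

/-- Orthogonality removes the cross terms of `‖Xβ‖²`, so the exponent is a sum over groups. -/
lemma likelihood_eq (hD : D.BlockOrthogonal) (σ : ℝ) (y : EuclideanSpace ℝ (Fin n))
    (β : D.Coef) :
    D.likelihood σ y β = likelihoodConst σ y *
      ∏ g, groupLikelihood (D.gram g) (σ ^ 2) (D.score y g) (β g) := by
  unfold likelihood likelihoodConst groupLikelihood
  rw [norm_sub_mean_sq hD, ← Real.exp_sum, mul_assoc (_ ^ _), ← Real.exp_add, ← Finset.sum_div]
  congr 2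
  ring

lemma continuous_likelihood (hD : D.BlockOrthogonal) (σ : ℝ) (y : EuclideanSpace ℝ (Fin n)) :
    Continuous (D.likelihood σ y) := by
  rw [funext (likelihood_eq hD σ y)]
  have := fun g => continuous_groupLikelihood (D.gram g) (σ ^ 2) (D.score y g)
  fun_prop

lemma likelihood_pos {σ : ℝ} (hσ : 0 < σ) (y : EuclideanSpace ℝ (Fin n)) (β : D.Coef) :
    0 < D.likelihood σ y β := by
  unfold likelihood
  have := Real.pi_pos
  positivity

lemma likelihood_le {σ : ℝ} (hσ : 0 < σ) (y : EuclideanSpace ℝ (Fin n)) (β : D.Coef) :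
    D.likelihood σ y β ≤ (2 * Real.pi * σ ^ 2) ^ (-(n : ℝ) / 2) := by
  unfold likelihood
  have := Real.pi_pos
  refine mul_le_of_le_one_right (by positivity) (Real.exp_le_one_iff.2 ?_)
  exact div_nonpos_of_nonpos_of_nonneg (by simp) (by positivity)

lemma integrable_likelihood_smul (hD : D.BlockOrthogonal) {σ : ℝ} (hσ : 0 < σ) (τ : ℝ)
    (y : EuclideanSpace ℝ (Fin n)) (lam : Fin D.numGroups → ℝ) (g : Fin D.numGroups) :
    Integrable (fun β => D.likelihood σ y β • β g) (D.coefPrior σ τ lam) := by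
  have h : Integrable (fun β : D.Coef => β g) (D.coefPrior σ τ lam) :=
    integrable_comp_eval (f := fun b => b) IsGaussian.integrable_fun_id
  refine h.bdd_smul (C := (2 * Real.pi * σ ^ 2) ^ (-(n : ℝ) / 2))
    (φ := D.likelihood σ y) (continuous_likelihood hD σ y).aestronglyMeasurable
    (ae_of_all _ fun β => ?_)
  rw [Real.norm_of_nonneg (likelihood_pos hσ y β).le]
  exact likelihood_le hσ y β

lemma integral_likelihood (hD : D.BlockOrthogonal) (hg : ∀ g, (D.gram g).PosDef) {σ τ : ℝ}
    (hσ : 0 < σ) (hτ : 0 < τ) (y : EuclideanSpace ℝ (Fin n)) {lam : Fin D.numGroups → ℝ}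
    (hlam : ∀ g, 0 < lam g) :
    ∫ β, D.likelihood σ y β ∂(D.coefPrior σ τ lam) =
      (likelihoodConst σ y * ∏ g, Real.exp (D.projSq y g / σ ^ 2 / 2)) *
        ∏ g, shrinkKernel (D.size g / 2) (D.projSq y g / σ ^ 2) τ (lam g) := by
  simp_rw [likelihood_eq hD, coefPrior]
  rw [integral_const_mul, integral_fintype_prod_eq_prod
    (f := fun g => groupLikelihood (D.gram g) (σ ^ 2) (D.score y g))]
  simp_rw [integral_groupLikelihood (hg _) (hlam _) hτ hσ]
  rw [Finset.prod_mul_distrib, mul_assoc]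
  simp [projSq]

lemma integral_likelihood_smul (hD : D.BlockOrthogonal) (hg : ∀ g, (D.gram g).PosDef) {σ τ : ℝ}
    (hσ : 0 < σ) (hτ : 0 < τ) (y : EuclideanSpace ℝ (Fin n)) {lam : Fin D.numGroups → ℝ}
    (hlam : ∀ g, 0 < lam g) (g : Fin D.numGroups) :
    ∫ β, D.likelihood σ y β • β g ∂(D.coefPrior σ τ lam) =
      (∫ β, D.likelihood σ y β • (1 - 1 / (1 + lam g * τ ^ 2)) ∂(D.coefPrior σ τ lam)) •
        WithLp.toLp 2 ((D.gram g)⁻¹ *ᵥ D.score y g) := by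
  ext j
  rw [integral_euclidean_apply (integrable_likelihood_smul hD hσ τ y lam g)]
  simp only [PiLp.smul_apply, smul_eq_mul]
  rw [integral_mul_const]
  simp_rw [likelihood_eq hD, mul_assoc, coefPrior]
  rw [integral_const_mul, integral_const_mul]
  have h1 := integral_groupLikelihood_smul (hg g) (hlam g) hτ hσ (D.score y g)
  have h2 := congrArg (fun v : EuclideanSpace ℝ (Fin (D.size g)) => v j) h1
  simp only [integral_euclidean_apply
    (integrable_groupLikelihood_smul (hg g) (hlam g) hτ hσ (D.score y g)),
    PiLp.smul_apply, smul_eq_mul] at h2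
  rw [integral_pi_prod_mul_eval
    (fun g => groupLikelihood (D.gram g) (σ ^ 2) (D.score y g)) g (fun b => b j)
    (r := (1 - shrinkFactor τ (lam g)) * ((D.gram g)⁻¹ *ᵥ D.score y g) j)
    (by rw [h2]; ring)]
  rw [integral_fintype_prod_eq_prod
    (f := fun g => groupLikelihood (D.gram g) (σ ^ 2) (D.score y g))]
  simp only [shrinkFactor]
  ring

lemma ae_pi_localPrior_pos {a : ℝ} {L : ℝ → ℝ} (hL : PolynomialTail a L) {ι : Type*} [Fintype ι] :
    ∀ᵐ lam ∂(Measure.pi fun _ : ι => localPrior a L), ∀ g, 0 < lam g := by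
  have := hL.isProbabilityMeasure
  rw [ae_all_iff]
  exact fun g => (Measure.quasiMeasurePreserving_eval (μ := fun _ : ι => localPrior a L) g).ae
    (ae_localPrior_pos a L)

lemma projSq_nonneg (hg : ∀ g, (D.gram g).PosDef) (y : EuclideanSpace ℝ (Fin n))
    (g : Fin D.numGroups) : 0 ≤ D.projSq y g := by
  have := (hg g).inv.posSemidef.dotProduct_mulVec_nonneg (D.score y g)
  simpa [projSq] using this

/-- Integrating out the coefficients leaves a product over groups; the constants and all the other
groups cancel in the Bayes ratio. -/
lemma shrinkageWeight_eq (hD : D.BlockOrthogonal) (hg : ∀ g, (D.gram g).PosDef) {a : ℝ}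
    {L : ℝ → ℝ} (hL : PolynomialTail a L) {σ τ : ℝ} (hσ : 0 < σ) (hτ : 0 < τ)
    (y : EuclideanSpace ℝ (Fin n)) (g : Fin D.numGroups) :
    D.shrinkageWeight a L σ τ y g =
      1 - shrinkMean a L (D.size g / 2) (D.projSq y g / σ ^ 2) τ := by
  have := hL.isProbabilityMeasure
  have hp : ∀ h, 0 ≤ (D.size h : ℝ) / 2 := fun h => by positivity
  have hq : ∀ h, 0 ≤ D.projSq y h / σ ^ 2 := fun h =>
    div_nonneg (projSq_nonneg hg y h) (by positivity)
  set c := likelihoodConst σ y * ∏ g, Real.exp (D.projSq y g / σ ^ 2 / 2) with hc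
  have hc0 : c ≠ 0 := by
    have := likelihoodConst_pos hσ y
    positivity
  set k := fun h => shrinkKernel (D.size h / 2) (D.projSq y h / σ ^ 2) τ with hk
  set I := fun h => ∫ t, k h t ∂(localPrior a L) with hI
  have hIpos : ∀ h, 0 < I h := fun h => integral_shrinkKernel_pos hL τ (hp h) (hq h)
  have e1 : (D.priorExp a L σ τ fun _ β => D.likelihood σ y β) = c * ∏ h, I h := by
    rw [priorExp, hI, ← integral_fintype_prod_eq_prod (f := k), ← integral_const_mul]
    refine integral_congr_ae ?_
    filter_upwards [ae_pi_localPrior_pos hL] with lam hlam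
    exact integral_likelihood hD hg hσ hτ y hlam
  set r := 1 - shrinkMean a L (D.size g / 2) (D.projSq y g / σ ^ 2) τ with hr
  have hkey : ∫ t, k g t * (1 - 1 / (1 + t * τ ^ 2)) ∂(localPrior a L) = r * I g := by
    have h1 : ∫ t, k g t * (1 - 1 / (1 + t * τ ^ 2)) ∂(localPrior a L) =
        ∫ t, (k g t - shrinkKernel (D.size g / 2 + 1) (D.projSq y g / σ ^ 2) τ t)
          ∂(localPrior a L) := by
      refine integral_congr_ae ?_
      filter_upwards [ae_localPrior_pos a L] with t ht
      rw [shrinkKernel_add_one ht, shrinkFactor, hk]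
      ring
    rw [h1, integral_sub (integrable_shrinkKernel hL τ (hp g) (hq g))
      (integrable_shrinkKernel hL τ (by linarith [hp g]) (hq g)), hr, shrinkMean, sub_mul, one_mul,
      div_mul_cancel₀ _ (hIpos g).ne']
  have e2 : (D.priorExp a L σ τ fun lam β =>
      D.likelihood σ y β • (1 - 1 / (1 + lam g * τ ^ 2))) = c * (r * ∏ h, I h) := by
    rw [priorExp, hI, ← integral_pi_prod_mul_eval k g _ hkey, ← integral_const_mul]
    refine integral_congr_ae ?_
    filter_upwards [ae_pi_localPrior_pos hL] with lam hlam
    simp only [smul_eq_mul]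
    rw [integral_mul_const, integral_likelihood hD hg hσ hτ y hlam, mul_assoc]
  rw [shrinkageWeight, posteriorExp, e1, e2, smul_eq_mul]
  have : ∏ h, I h ≠ 0 := Finset.prod_ne_zero_iff.2 fun h _ => (hIpos h).ne'
  field_simp

/-- The least squares vector does not depend on the local parameters, so it factors out of the
average of `1 - κ_g`. -/
lemma posteriorMean_eq (hD : D.BlockOrthogonal) (hg : ∀ g, (D.gram g).PosDef) {a : ℝ}
    {L : ℝ → ℝ} (hL : PolynomialTail a L) {σ τ : ℝ} (hσ : 0 < σ) (hτ : 0 < τ)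
    (y : EuclideanSpace ℝ (Fin n)) (g : Fin D.numGroups) :
    D.posteriorMean a L σ τ y g =
      D.shrinkageWeight a L σ τ y g • WithLp.toLp 2 ((D.gram g)⁻¹ *ᵥ D.score y g) := by
  have e : (D.priorExp a L σ τ fun _ β => D.likelihood σ y β • β g) =
      (D.priorExp a L σ τ fun lam β => D.likelihood σ y β • (1 - 1 / (1 + lam g * τ ^ 2))) •
        WithLp.toLp 2 ((D.gram g)⁻¹ *ᵥ D.score y g) := by
    rw [priorExp, priorExp, ← integral_smul_const]
    refine integral_congr_ae ?_
    filter_upwards [ae_pi_localPrior_pos hL] with lam hlam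
    exact integral_likelihood_smul hD hg hσ hτ y hlam g
  rw [posteriorMean, shrinkageWeight, posteriorExp, posteriorExp, e, smul_assoc]

end GroupedDesign

/-! ### Gram matrices, least squares and the range of the estimated `τ`. -/

lemma Matrix.IsHermitian.posSemidef_sub_smul_one {ι : Type*} [Fintype ι] [DecidableEq ι]
    {A : Matrix ι ι ℝ} (hA : A.IsHermitian) {c : ℝ} (h : ∀ i, c ≤ hA.eigenvalues i) :
    (A - c • 1).PosSemidef := by
  have h1 : algebraMap ℝ (Matrix ι ι ℝ) c ≤ A := by
    refine (algebraMap_le_iff_le_spectrum (ha := hA)).2 fun x hx => ?_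
    rw [hA.spectrum_real_eq_range_eigenvalues] at hx
    obtain ⟨i, rfl⟩ := hx
    exact h i
  rwa [Matrix.le_iff, Algebra.algebraMap_eq_smul_one] at h1

namespace GroupedDesign

variable {n : ℕ} {D : GroupedDesign n}

lemma gram_eq_submatrix (g : Fin D.numGroups) :
    D.gram g = (D.matrixᵀ * D.matrix).submatrix (Sigma.mk g) (Sigma.mk g) := rfl

lemma EigenvalueBounds.mul_le {C₁ C₂ : ℝ} (hC₁ : 0 < C₁) (h : D.EigenvalueBounds C₁ C₂) :
    ∀ i, C₁ * n ≤ D.isHermitian_fullGram.eigenvalues i := fun i => by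
  have h1 := (h i).1
  -- For `n = 0` the convention `1 / 0 = 0` turns the eigenvalue bound into `C₁ ≤ 0`, a
  -- contradiction.
  rcases n.eq_zero_or_pos with hn | hn
  · have : (n : ℝ) = 0 := by exact_mod_cast hn
    rw [this, div_zero, zero_mul] at h1
    linarith
  · have : (0 : ℝ) < n := by exact_mod_cast hn
    rwa [one_div, inv_mul_eq_div, le_div_iff₀ this] at h1

lemma EigenvalueBounds.posDef_fullGram {C₁ C₂ : ℝ} (hC₁ : 0 < C₁)
    (h : D.EigenvalueBounds C₁ C₂) : (D.matrixᵀ * D.matrix).PosDef := by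
  rw [D.isHermitian_fullGram.posDef_iff_eigenvalues_pos]
  intro i
  have h1 := hC₁.trans_le (h i).1
  by_contra hcon
  exact h1.not_ge (mul_nonpos_of_nonneg_of_nonpos (by positivity) (not_lt.1 hcon))

lemma EigenvalueBounds.posDef_gram {C₁ C₂ : ℝ} (hC₁ : 0 < C₁)
    (h : D.EigenvalueBounds C₁ C₂) (g : Fin D.numGroups) : (D.gram g).PosDef := by
  rw [gram_eq_submatrix]
  exact (h.posDef_fullGram hC₁).submatrix sigma_mk_injective

/-- The Gram matrix of a group is a principal submatrix of `Xᵀ X` and inherits its lower bound. -/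
lemma EigenvalueBounds.le_dotProduct_gram {C₁ C₂ : ℝ} (hC₁ : 0 < C₁)
    (h : D.EigenvalueBounds C₁ C₂) (g : Fin D.numGroups) (b : EuclideanSpace ℝ (Fin (D.size g))) :
    C₁ * n * ‖b‖ ^ 2 ≤ b ⬝ᵥ (D.gram g *ᵥ b) := by
  have h1 := (D.isHermitian_fullGram.posSemidef_sub_smul_one (h.mul_le hC₁)).submatrix
    (fun j => (⟨g, j⟩ : D.Index))
  have h2 : (D.matrixᵀ * D.matrix - (C₁ * n) • 1).submatrix (fun j => (⟨g, j⟩ : D.Index))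
      (fun j => ⟨g, j⟩) =
      D.gram g - (C₁ * n) • 1 := by
    rw [Matrix.submatrix_sub, Matrix.submatrix_smul, gram_eq_submatrix]
    simp only [Pi.sub_apply, Pi.smul_apply]
    rw [Matrix.submatrix_one _ sigma_mk_injective]
  rw [h2] at h1
  have h3 := h1.dotProduct_mulVec_nonneg b
  rw [star_trivial, Matrix.sub_mulVec, dotProduct_sub, Matrix.smul_mulVec, Matrix.one_mulVec,
    dotProduct_smul, smul_eq_mul] at h3
  have h4 : (b : Fin (D.size g) → ℝ) ⬝ᵥ b = ‖b‖ ^ 2 := by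
    rw [EuclideanSpace.real_norm_sq_eq]
    simp [dotProduct, pow_two]
  rw [h4] at h3
  linarith

/-- The blockwise solutions together solve the full normal equations, since the off-diagonal blocks
vanish. -/
lemma leastSquares_eq (hD : D.BlockOrthogonal) (hX : (D.matrixᵀ * D.matrix).PosDef)
    (hg : ∀ g, (D.gram g).PosDef) (y : EuclideanSpace ℝ (Fin n)) (g : Fin D.numGroups) :
    D.leastSquares y g = WithLp.toLp 2 ((D.gram g)⁻¹ *ᵥ D.score y g) := by
  set x : D.Index → ℝ := fun k => ((D.gram k.1)⁻¹ *ᵥ D.score y k.1) k.2 with hx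
  have h1 : (D.matrixᵀ * D.matrix) *ᵥ x = D.matrixᵀ *ᵥ y := by
    ext ⟨h, i⟩
    have e1 : ((D.matrixᵀ * D.matrix) *ᵥ x) ⟨h, i⟩ =
        ∑ k, (((D.block h)ᵀ * D.block k) *ᵥ ((D.gram k)⁻¹ *ᵥ D.score y k)) i := by
      rw [Matrix.mulVec, dotProduct, Fintype.sum_sigma]
      rfl
    have e2 : (D.matrixᵀ *ᵥ y) ⟨h, i⟩ = D.score y h i := rfl
    have hu : IsUnit (D.gram h).det := (Matrix.isUnit_iff_isUnit_det _).1 (hg h).isUnit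
    rw [e1, e2, Finset.sum_eq_single h, ← gram, Matrix.mulVec_mulVec, Matrix.mul_nonsing_inv _ hu,
      Matrix.one_mulVec]
    · intro k _ hk
      rw [hD h k hk.symm]
      simp
    · simp
  have hu : IsUnit (D.matrixᵀ * D.matrix).det := (Matrix.isUnit_iff_isUnit_det _).1 hX.isUnit
  ext j
  rw [leastSquares, ← h1, Matrix.mulVec_mulVec, Matrix.nonsing_inv_mul _ hu, Matrix.one_mulVec]

lemma leastSquares_quadForm (hg : ∀ g, (D.gram g).PosDef) (y : EuclideanSpace ℝ (Fin n))
    (g : Fin D.numGroups) :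
    ((D.gram g)⁻¹ *ᵥ D.score y g) ⬝ᵥ (D.gram g *ᵥ ((D.gram g)⁻¹ *ᵥ D.score y g)) =
      D.projSq y g := by
  have hu : IsUnit (D.gram g).det := (Matrix.isUnit_iff_isUnit_det _).1 (hg g).isUnit
  rw [Matrix.mulVec_mulVec, Matrix.mul_nonsing_inv _ hu, Matrix.one_mulVec, projSq,
    dotProduct_comm]

lemma one_div_le_tauEB (c₁ c₂ σ : ℝ) (y : EuclideanSpace ℝ (Fin n)) :
    1 / (D.numGroups : ℝ) ≤ D.tauEB c₁ c₂ σ y := le_max_left _ _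

lemma tauEB_pos (c₁ c₂ σ : ℝ) (y : EuclideanSpace ℝ (Fin n)) (g : Fin D.numGroups) :
    0 < D.tauEB c₁ c₂ σ y := by
  have : (0 : ℝ) < D.numGroups := by exact_mod_cast g.pos
  exact lt_of_lt_of_le (by positivity) (one_div_le_tauEB c₁ c₂ σ y)

lemma tauEB_le_one (c₁ : ℝ) {c₂ : ℝ} (hc₂ : 1 ≤ c₂) (σ : ℝ) (y : EuclideanSpace ℝ (Fin n))
    (g : Fin D.numGroups) : D.tauEB c₁ c₂ σ y ≤ 1 := by
  have hG : (1 : ℝ) ≤ D.numGroups := by exact_mod_cast g.pos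
  refine max_le ((div_le_one (by linarith)).2 hG) ?_
  rw [one_div, inv_mul_le_iff₀ (by positivity), mul_one]
  calc _ ≤ ∑ _ : Fin D.numGroups, (1 : ℝ) := Finset.sum_le_sum fun g _ => by split_ifs <;> simp
    _ = D.numGroups := by simp
    _ ≤ _ := by nlinarith

lemma halfThreshold_eq (hD : D.BlockOrthogonal) (hX : (D.matrixᵀ * D.matrix).PosDef)
    (hg : ∀ g, (D.gram g).PosDef) {a : ℝ}
    {L : ℝ → ℝ} (hL : PolynomialTail a L) {σ τ : ℝ} (hσ : 0 < σ) (hτ : 0 < τ)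
    (y : EuclideanSpace ℝ (Fin n)) (g : Fin D.numGroups) :
    D.halfThreshold a L σ τ y g =
      if shrinkMean a L (D.size g / 2) (D.projSq y g / σ ^ 2) τ < 1 / 2 then
        (1 - shrinkMean a L (D.size g / 2) (D.projSq y g / σ ^ 2) τ) • D.leastSquares y g
      else 0 := by
  rw [halfThreshold, posteriorMean_eq hD hg hL hσ hτ, shrinkageWeight_eq hD hg hL hσ hτ,
    leastSquares_eq hD hX hg]
  congr 1
  rw [gt_iff_lt, eq_iff_iff]
  constructor <;> intro h <;> linarith

/-! ### Contrasts of the active groups. -/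

open Classical in
/-- The coefficients `c`, with those of the inactive groups of `β` replaced by zero. -/
noncomputable def activeCoef (β c : D.Coef) : D.Coef := fun g => if β g ≠ 0 then c g else 0

lemma activeCoef_of_ne {β : D.Coef} (c : D.Coef) {g : Fin D.numGroups} (h : β g ≠ 0) :
    activeCoef β c g = c g := if_pos h

lemma activeCoef_of_eq {β : D.Coef} (c : D.Coef) {g : Fin D.numGroups} (h : β g = 0) :
    activeCoef β c g = 0 := if_neg (not_not.2 h)

lemma activeCoef_self (β : D.Coef) : activeCoef β β = β := by
  ext1 g
  by_cases h : β g = 0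
  · rw [activeCoef_of_eq β h, h]
  · rw [activeCoef_of_ne β h]

lemma activeMatrix_mulVec (β c : D.Coef) :
    D.activeMatrix β *ᵥ D.activePart β c = D.mean (activeCoef β c) := by
  classical
  ext i
  have e1 : (D.activeMatrix β *ᵥ D.activePart β c) i =
      ∑ k : {k : D.Index // β k.1 ≠ 0}, D.block k.1.1 i k.1.2 * c k.1.1 k.1.2 := by
    rw [Matrix.mulVec, dotProduct]
    exact Fintype.sum_equiv (Equiv.refl _) _ _ fun _ => rfl
  rw [e1, ← Finset.sum_subtype (Finset.univ.filter fun k : D.Index => β k.1 ≠ 0) (by simp)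
    (fun k : D.Index => D.block k.1 i k.2 * c k.1 k.2), Finset.sum_filter, Fintype.sum_sigma, mean]
  simp only [WithLp.ofLp_sum, Finset.sum_apply, Matrix.mulVec, dotProduct]
  refine Finset.sum_congr rfl fun g _ => Finset.sum_congr rfl fun j _ => ?_
  by_cases h : β g = 0
  · rw [activeCoef_of_eq c h]; simp [h]
  · rw [activeCoef_of_ne c h]; simp [h]

lemma activeGram_eq_submatrix (β : D.Coef) :
    D.activeGram β = (D.matrixᵀ * D.matrix).submatrix Subtype.val Subtype.val := rfl

lemma posDef_activeGram (hX : (D.matrixᵀ * D.matrix).PosDef) (β : D.Coef) :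
    (D.activeGram β).PosDef := by
  rw [activeGram_eq_submatrix]
  exact hX.submatrix Subtype.val_injective

lemma dotProduct_activeGram (β : D.Coef) (x : D.ActiveIndex β → ℝ) :
    x ⬝ᵥ (D.activeGram β *ᵥ x) = (D.activeMatrix β *ᵥ x) ⬝ᵥ (D.activeMatrix β *ᵥ x) := by
  rw [activeGram, ← Matrix.mulVec_mulVec, Matrix.dotProduct_mulVec, ← Matrix.mulVec_transpose,
    Matrix.transpose_transpose]

lemma dotProduct_activeGram_activePart (hD : D.BlockOrthogonal) (β c : D.Coef) :
    D.activePart β c ⬝ᵥ (D.activeGram β *ᵥ D.activePart β c) =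
      ∑ g, activeCoef β c g ⬝ᵥ (D.gram g *ᵥ activeCoef β c g) := by
  rw [dotProduct_activeGram, activeMatrix_mulVec, ← norm_mean_sq hD,
    EuclideanSpace.real_norm_sq_eq]
  simp [dotProduct, pow_two]

/-- Cauchy–Schwarz, with `‖Σ_A^{1/2} x‖² = xᵀ Σ_A x`. -/
lemma abs_dotProduct_sqrt_le (hX : (D.matrixᵀ * D.matrix).PosDef) (β : D.Coef)
    (α : EuclideanSpace ℝ (D.ActiveIndex β)) (x : D.ActiveIndex β → ℝ) :
    |α ⬝ᵥ (CFC.sqrt (D.activeGram β) *ᵥ x)| ≤ ‖α‖ * √(x ⬝ᵥ (D.activeGram β *ᵥ x)) := by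
  have hTT := CFC.sqrt_mul_sqrt_self (D.activeGram β) (posDef_activeGram hX β).posSemidef.nonneg
  have hT := Matrix.transpose_sqrt (D.activeGram β)
  set T := CFC.sqrt (D.activeGram β)
  have e1 : x ⬝ᵥ (D.activeGram β *ᵥ x) =
      ‖(WithLp.toLp 2 (T *ᵥ x) : EuclideanSpace ℝ (D.ActiveIndex β))‖ ^ 2 := by
    rw [← hTT, ← Matrix.mulVec_mulVec, Matrix.dotProduct_mulVec, ← Matrix.mulVec_transpose, hT,
      EuclideanSpace.real_norm_sq_eq]
    simp [dotProduct, pow_two]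
  have e2 : α ⬝ᵥ (T *ᵥ x) =
      inner ℝ α (WithLp.toLp 2 (T *ᵥ x) : EuclideanSpace ℝ (D.ActiveIndex β)) := by
    rw [PiLp.inner_apply]
    simp [dotProduct, mul_comm]
  rw [e1, e2, Real.sqrt_sq (norm_nonneg _)]
  exact abs_real_inner_le_norm _ _

/-- The vector `X_A Σ_A⁻¹ Σ_A^{1/2} α`. -/
noncomputable def contrastVec (β : D.Coef) (α : EuclideanSpace ℝ (D.ActiveIndex β)) :
    EuclideanSpace ℝ (Fin n) :=
  WithLp.toLp 2 (D.activeMatrix β *ᵥ ((D.activeGram β)⁻¹ *ᵥ (CFC.sqrt (D.activeGram β) *ᵥ α)))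

/-- The squared norm reduces to `αᵀ Σ_A^{1/2} Σ_A⁻¹ Σ_A^{1/2} α`, and the matrix in it is the
identity. This is why the limiting variance is exactly `σ²`. -/
lemma norm_contrastVec (hX : (D.matrixᵀ * D.matrix).PosDef) (β : D.Coef)
    (α : EuclideanSpace ℝ (D.ActiveIndex β)) : ‖contrastVec β α‖ = ‖α‖ := by
  have hpd := posDef_activeGram hX β
  have hu : IsUnit (D.activeGram β).det := (Matrix.isUnit_iff_isUnit_det _).1 hpd.isUnit
  have hconj := hpd.inv.sqrt_smul_inv_conj one_pos
  rw [one_smul, one_smul, Matrix.nonsing_inv_nonsing_inv _ hu] at hconj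
  have hT := Matrix.transpose_sqrt (D.activeGram β)
  rw [← sq_eq_sq₀ (norm_nonneg _) (norm_nonneg _), contrastVec]
  have e1 : ∀ {κ : Type} [Fintype κ] (v : κ → ℝ),
      ‖(WithLp.toLp 2 v : EuclideanSpace ℝ κ)‖ ^ 2 = v ⬝ᵥ v := fun v => by
    rw [EuclideanSpace.real_norm_sq_eq]
    simp [dotProduct, pow_two]
  have e2 : D.activeGram β *ᵥ ((D.activeGram β)⁻¹ *ᵥ (CFC.sqrt (D.activeGram β) *ᵥ α)) =
      CFC.sqrt (D.activeGram β) *ᵥ α := by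
    rw [Matrix.mulVec_mulVec, Matrix.mul_nonsing_inv _ hu, Matrix.one_mulVec]
  rw [e1, ← dotProduct_activeGram, e2, Matrix.dotProduct_mulVec, ← Matrix.mulVec_transpose, hT,
    Matrix.mulVec_mulVec, Matrix.mulVec_mulVec, hconj, Matrix.one_mulVec, ← e1]

lemma score_sub (y z : EuclideanSpace ℝ (Fin n)) (g : Fin D.numGroups) :
    D.score (y - z) g = D.score y g - D.score z g := by
  simp [score, Matrix.mulVec_sub]

lemma score_mean (hD : D.BlockOrthogonal) (c : D.Coef) (g : Fin D.numGroups) :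
    D.score (D.mean c) g = D.gram g *ᵥ c g := by
  rw [score, mean, WithLp.ofLp_sum, Matrix.mulVec_sum, Finset.sum_eq_single g]
  · rw [Matrix.mulVec_mulVec, gram]
  · intro h _ hh
    rw [Matrix.mulVec_mulVec, hD g h hh.symm, Matrix.zero_mulVec]
  · simp

lemma transpose_activeMatrix_mulVec (β : D.Coef) (y : EuclideanSpace ℝ (Fin n))
    (k : D.ActiveIndex β) : ((D.activeMatrix β)ᵀ *ᵥ y) k = D.score y k.1.1 k.1.2 := rfl

/-- The normal equations restricted to the active groups; the mean involves only these groups. -/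
lemma activeGram_mulVec_leastSquares (hD : D.BlockOrthogonal)
    (hX : (D.matrixᵀ * D.matrix).PosDef) (hg : ∀ g, (D.gram g).PosDef) (β : D.Coef)
    (y : EuclideanSpace ℝ (Fin n)) :
    D.activeGram β *ᵥ (D.activePart β (D.leastSquares y) - D.activePart β β) =
      (D.activeMatrix β)ᵀ *ᵥ (y - D.mean β : EuclideanSpace ℝ (Fin n)) := by
  rw [Matrix.mulVec_sub, activeGram, ← Matrix.mulVec_mulVec, ← Matrix.mulVec_mulVec,
    activeMatrix_mulVec, activeMatrix_mulVec, activeCoef_self]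
  ext k
  have hu : IsUnit (D.gram k.1.1).det := (Matrix.isUnit_iff_isUnit_det _).1 (hg k.1.1).isUnit
  rw [transpose_activeMatrix_mulVec, Pi.sub_apply, transpose_activeMatrix_mulVec,
    transpose_activeMatrix_mulVec, score_sub, score_mean hD, activeCoef_of_ne _ k.2,
    leastSquares_eq hD hX hg, Matrix.mulVec_mulVec, Matrix.mul_nonsing_inv _ hu,
    Matrix.one_mulVec, Pi.sub_apply]

/-- The contrast of least squares is linear in the noise, with no remainder. -/
lemma activeContrast_leastSquares (hD : D.BlockOrthogonal) (hX : (D.matrixᵀ * D.matrix).PosDef)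
    (hg : ∀ g, (D.gram g).PosDef) (β : D.Coef) (α : EuclideanSpace ℝ (D.ActiveIndex β))
    (y : EuclideanSpace ℝ (Fin n)) :
    D.activeContrast β α (D.leastSquares y) = inner ℝ (contrastVec β α) (y - D.mean β) := by
  have hpd := posDef_activeGram hX β
  have hu : IsUnit (D.activeGram β).det := (Matrix.isUnit_iff_isUnit_det _).1 hpd.isUnit
  have hT := Matrix.transpose_sqrt (D.activeGram β)
  have hS : (D.activeGram β)ᵀ = D.activeGram β := by
    rw [activeGram, Matrix.transpose_mul, Matrix.transpose_transpose]
  have e1 : ∀ u v : EuclideanSpace ℝ (Fin n), inner ℝ u v = (u : Fin n → ℝ) ⬝ᵥ v := fun u v => by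
    rw [PiLp.inner_apply]
    simp [dotProduct, mul_comm]
  have e2 : D.activeGram β *ᵥ ((D.activeGram β)⁻¹ *ᵥ (CFC.sqrt (D.activeGram β) *ᵥ α)) =
      CFC.sqrt (D.activeGram β) *ᵥ α := by
    rw [Matrix.mulVec_mulVec, Matrix.mul_nonsing_inv _ hu, Matrix.one_mulVec]
  rw [e1, contrastVec, dotProduct_comm, Matrix.dotProduct_mulVec, ← Matrix.mulVec_transpose,
    ← activeGram_mulVec_leastSquares hD hX hg, dotProduct_comm, Matrix.dotProduct_mulVec,
    ← Matrix.mulVec_transpose, hS, e2, activeContrast, Matrix.dotProduct_mulVec,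
    ← Matrix.mulVec_transpose, hT]

lemma activeContrast_sub (β : D.Coef) (α : EuclideanSpace ℝ (D.ActiveIndex β)) (b c : D.Coef) :
    D.activeContrast β α b - D.activeContrast β α c =
      α ⬝ᵥ (CFC.sqrt (D.activeGram β) *ᵥ D.activePart β (b - c)) := by
  rw [activeContrast, activeContrast, ← dotProduct_sub, ← Matrix.mulVec_sub]
  congr 2
  ext k
  simp [activePart]

open Classical in
/-- Estimates whose groups are multiples of the least squares estimates have almost the same
contrast as the latter when the multipliers are close to one in the active groups. -/
lemma abs_activeContrast_sub_leastSquares_le (hD : D.BlockOrthogonal)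
    (hX : (D.matrixᵀ * D.matrix).PosDef) (hg : ∀ g, (D.gram g).PosDef) (β : D.Coef)
    (α : EuclideanSpace ℝ (D.ActiveIndex β)) (y : EuclideanSpace ℝ (Fin n))
    (w : Fin D.numGroups → ℝ) {b : D.Coef}
    (hb : ∀ g, β g ≠ 0 → b g = (1 - w g) • D.leastSquares y g) :
    |D.activeContrast β α b - D.activeContrast β α (D.leastSquares y)| ≤
      ‖α‖ * √(∑ g with β g ≠ 0, w g ^ 2 * D.projSq y g) := by
  rw [activeContrast_sub]
  refine (abs_dotProduct_sqrt_le hX β α _).trans (le_of_eq ?_)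
  rw [dotProduct_activeGram_activePart hD, Finset.sum_filter]
  congr 2
  refine Finset.sum_congr rfl fun g _ => ?_
  by_cases h : β g = 0
  · rw [activeCoef_of_eq _ h]; simp [h]
  · rw [activeCoef_of_ne _ h, if_pos h, Pi.sub_apply, hb g h, ← leastSquares_quadForm hg,
      leastSquares_eq hD hX hg]
    have : ∀ v : EuclideanSpace ℝ (Fin (D.size g)), (1 - w g) • v - v = (-w g) • v := fun v => by
      module
    rw [this]
    simp only [WithLp.ofLp_smul, Matrix.mulVec_smul, smul_dotProduct, dotProduct_smul,
      smul_eq_mul]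
    ring

/-- Projection onto a single direction: `⟨y, X_g b⟩² ≤ ‖P_g y‖² ‖X_g b‖²`. -/
lemma sq_score_dotProduct_le (hg : ∀ g, (D.gram g).PosDef) (y : EuclideanSpace ℝ (Fin n))
    (g : Fin D.numGroups) (b : EuclideanSpace ℝ (Fin (D.size g))) :
    (D.score y g ⬝ᵥ b) ^ 2 ≤ D.projSq y g * (b ⬝ᵥ (D.gram g *ᵥ b)) := by
  have hu : IsUnit (D.gram g).det := (Matrix.isUnit_iff_isUnit_det _).1 (hg g).isUnit
  have key : ∀ v : Fin (D.size g) → ℝ, v ⬝ᵥ (D.gram g *ᵥ v) =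
      ‖(WithLp.toLp 2 (D.block g *ᵥ v) : EuclideanSpace ℝ (Fin n))‖ ^ 2 := fun v => by
    rw [gram, ← Matrix.mulVec_mulVec, Matrix.dotProduct_mulVec, ← Matrix.mulVec_transpose,
      Matrix.transpose_transpose, EuclideanSpace.real_norm_sq_eq]
    simp [dotProduct, pow_two]
  rw [← leastSquares_quadForm hg, key, key, ← mul_pow]
  have hin : D.score y g ⬝ᵥ b =
      inner ℝ (WithLp.toLp 2 (D.block g *ᵥ ((D.gram g)⁻¹ *ᵥ D.score y g)) :
        EuclideanSpace ℝ (Fin n)) (WithLp.toLp 2 (D.block g *ᵥ b)) := by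
    rw [inner_block]
    conv_rhs => rw [score, Matrix.mulVec_mulVec, ← gram,
      Matrix.mulVec_mulVec, Matrix.mul_nonsing_inv _ hu, Matrix.one_mulVec]
  rw [hin]
  exact sq_le_sq' (neg_le_of_abs_le (abs_real_inner_le_norm _ _)) (real_inner_le_norm _ _)

end GroupedDesign

/-! ### Gaussian projections and comparison of characteristic functions. -/

lemma map_inner_sub_multivariateGaussian {ι : Type*} [Fintype ι] [DecidableEq ι] (σ : ℝ)
    (μ c : EuclideanSpace ℝ ι) :
    (multivariateGaussian μ (σ ^ 2 • 1)).map (fun y => inner ℝ c (y - μ)) =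
      gaussianReal 0 (σ ^ 2 * ‖c‖ ^ 2).toNNReal := by
  have hps : (σ ^ 2 • (1 : Matrix ι ι ℝ)).PosSemidef := Matrix.PosSemidef.one.smul (sq_nonneg σ)
  have hTT := CFC.sqrt_mul_sqrt_self (σ ^ 2 • (1 : Matrix ι ι ℝ)) hps.nonneg
  have hT := Matrix.transpose_sqrt (σ ^ 2 • (1 : Matrix ι ι ℝ))
  rw [multivariateGaussian, Measure.map_map (by fun_prop) (by fun_prop)]
  set T := CFC.sqrt (σ ^ 2 • (1 : Matrix ι ι ℝ))
  set w : EuclideanSpace ℝ ι := WithLp.toLp 2 (T *ᵥ c) with hw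
  have e0 : ∀ u v : EuclideanSpace ℝ ι, inner ℝ u v = (u : ι → ℝ) ⬝ᵥ v := fun u v => by
    rw [PiLp.inner_apply]
    simp [dotProduct, mul_comm]
  have e1 : (fun y => inner ℝ c (y - μ)) ∘ (fun x => μ + toEuclideanCLM (𝕜 := ℝ) T x) =
      innerSL ℝ w := by
    ext x
    simp only [Function.comp_apply, add_sub_cancel_left, innerSL_apply_apply]
    rw [e0, e0, Matrix.ofLp_toEuclideanCLM, Matrix.dotProduct_mulVec, ← Matrix.mulVec_transpose, hT]
  have e2 : ‖w‖ ^ 2 = σ ^ 2 * ‖c‖ ^ 2 := by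
    rw [← real_inner_self_eq_norm_sq, ← real_inner_self_eq_norm_sq, e0, e0, hw]
    rw [Matrix.dotProduct_mulVec, ← Matrix.mulVec_transpose, hT, Matrix.mulVec_mulVec, hTT,
      Matrix.smul_mulVec, Matrix.one_mulVec, smul_dotProduct, smul_eq_mul]
  rw [e1, IsGaussian.map_eq_gaussianReal, integral_strongDual_stdGaussian,
    variance_dual_stdGaussian, innerSL_apply_norm, e2]

/-- The function `exp(i t x)` is `|t|`-Lipschitz in `x` and of modulus one, so the error is at most
`|t| |δ|` plus twice the exceptional probability. The probability spaces may vary with `n`. -/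
lemma tendsto_charFun_of_close {E : ℕ → Type*} [∀ n, MeasurableSpace (E n)]
    (μ : (n : ℕ) → Measure (E n)) [∀ n, IsProbabilityMeasure (μ n)] (ν : Measure ℝ)
    {X Y : (n : ℕ) → E n → ℝ} (hX : ∀ n, Measurable (X n)) (hY : ∀ n, Measurable (Y n))
    (hlaw : ∀ᶠ n in atTop, (μ n).map (X n) = ν) {B : (n : ℕ) → Set (E n)}
    (hB : ∀ n, MeasurableSet (B n)) (hB0 : Tendsto (fun n => (μ n).real (B n)) atTop (𝓝 0))
    {δ : ℕ → ℝ} (hδ : Tendsto δ atTop (𝓝 0))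
    (hclose : ∀ᶠ n in atTop, ∀ x ∉ B n, |Y n x - X n x| ≤ δ n) (t : ℝ) :
    Tendsto (fun n => charFun ((μ n).map (Y n)) t) atTop (𝓝 (charFun ν t)) := by
  rw [tendsto_iff_norm_sub_tendsto_zero]
  have hlim : Tendsto (fun n => |t| * |δ n| + 2 * (μ n).real (B n)) atTop (𝓝 0) := by
    simpa using (hδ.abs.const_mul |t|).add (hB0.const_mul 2)
  refine squeeze_zero' (Eventually.of_forall fun n => norm_nonneg _) ?_ hlim
  filter_upwards [hlaw, hclose] with n hn hc
  have hmeas : ∀ Z : E n → ℝ, Measurable Z →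
      Integrable (fun x => Complex.exp ((t * Z x : ℝ) * Complex.I)) (μ n) := fun Z hZ => by
    refine Integrable.of_bound (by fun_prop) 1 (ae_of_all _ fun x => ?_)
    rw [Complex.norm_exp_ofReal_mul_I]
  have hchar : ∀ Z : E n → ℝ, Measurable Z → charFun ((μ n).map Z) t =
      ∫ x, Complex.exp ((t * Z x : ℝ) * Complex.I) ∂(μ n) := fun Z hZ => by
    rw [charFun_apply_real, integral_map hZ.aemeasurable (by fun_prop)]
    simp
  rw [← hn, hchar _ (hY n), hchar _ (hX n), ← integral_sub (hmeas _ (hY n)) (hmeas _ (hX n))]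
  have hbound : ∀ x, ‖Complex.exp ((t * Y n x : ℝ) * Complex.I) -
      Complex.exp ((t * X n x : ℝ) * Complex.I)‖ ≤
        |t| * |δ n| + (B n).indicator (fun _ => (2 : ℝ)) x := fun x => by
    by_cases hx : x ∈ B n
    · rw [Set.indicator_of_mem hx]
      refine (norm_sub_le _ _).trans ?_
      rw [Complex.norm_exp_ofReal_mul_I, Complex.norm_exp_ofReal_mul_I]
      have : 0 ≤ |t| * |δ n| := by positivity
      linarith
    · rw [Set.indicator_of_notMem hx, add_zero]
      have e : Complex.exp ((t * Y n x : ℝ) * Complex.I) -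
          Complex.exp ((t * X n x : ℝ) * Complex.I) =
          Complex.exp ((t * X n x : ℝ) * Complex.I) *
            (Complex.exp (Complex.I * (t * (Y n x - X n x) : ℝ)) - 1) := by
        rw [mul_sub, mul_one, ← Complex.exp_add]
        congr 2
        push_cast
        ring
      rw [e, norm_mul, Complex.norm_exp_ofReal_mul_I, one_mul]
      refine (Real.norm_exp_I_mul_ofReal_sub_one_le).trans ?_
      rw [Real.norm_eq_abs, abs_mul]
      exact mul_le_mul_of_nonneg_left ((hc x hx).trans (le_abs_self _)) (abs_nonneg t)
  have hint : Integrable (fun x => |t| * |δ n| + (B n).indicator (fun _ => (2 : ℝ)) x) (μ n) :=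
    (integrable_const _).add ((integrable_const _).indicator (hB n))
  refine (norm_integral_le_of_norm_le hint (ae_of_all _ hbound)).trans (le_of_eq ?_)
  rw [integral_add (integrable_const _) ((integrable_const _).indicator (hB n)),
    integral_indicator (hB n), setIntegral_const, integral_const]
  simp [mul_comm]

/-! ### Measurability and uniformity of the shrinkage mean. -/

lemma Measurable.shrinkMean {α : Type*} [MeasurableSpace α] {a : ℝ} {L : ℝ → ℝ}
    (hL : PolynomialTail a L) (p : ℝ) {f h : α → ℝ} (hf : Measurable f) (hh : Measurable h) :
    Measurable fun x => shrinkMean a L p (f x) (h x) := by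
  have := hL.isProbabilityMeasure
  have hint : ∀ p : ℝ, Measurable fun x =>
      ∫ t, shrinkKernel p (f x) (h x) t ∂(localPrior a L) := fun p => by
    refine (StronglyMeasurable.integral_prod_right (f := fun x t =>
      shrinkKernel p (f x) (h x) t) (Measurable.stronglyMeasurable ?_)).measurable
    unfold Function.uncurry shrinkKernel shrinkFactor
    fun_prop
  exact (hint (p + 1)).div (hint p)

lemma shrinkMean_nonneg {a : ℝ} {L : ℝ → ℝ} (p q τ : ℝ) :
    0 ≤ shrinkMean a L p q τ := by
  refine div_nonneg (integral_nonneg_of_ae ?_) (integral_nonneg_of_ae ?_) <;>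
  · filter_upwards [ae_localPrior_pos a L] with t ht
    exact shrinkKernel_nonneg ht

/-- Bounded group sizes leave finitely many exponents `m/2`; summing the constants over `m ≤ s`
dominates each of them. -/
lemma exists_shrinkMean_le {a : ℝ} {L : ℝ → ℝ} (hL : PolynomialTail a L) (hL' : TailBounds a L)
    (s : ℕ) {K : ℝ} (hK : 0 < K) :
    ∃ C > 0, ∃ q₀ ≥ 1, ∀ m ≤ s, ∀ q τ : ℝ, q₀ ≤ q → 0 < τ → τ ≤ 1 → 1 / τ ≤ K * q →
      shrinkMean a L (m / 2) q τ ≤ C / q := by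
  have h : ∀ m : ℕ, ∃ C > 0, ∃ q₀ ≥ 1, ∀ q τ : ℝ, q₀ ≤ q → 0 < τ → τ ≤ 1 → 1 / τ ≤ K * q →
      shrinkMean a L (m / 2) q τ ≤ C / q := fun m => by
    obtain ⟨C, hC, q₀, hq₀, h⟩ := exists_integral_shrinkKernel_succ_le hL hL'
      (p := (m : ℝ) / 2) (by positivity) hK
    refine ⟨C, hC, q₀, hq₀, fun q τ hq hτ hτ1 hKq => ?_⟩
    rw [shrinkMean, div_le_iff₀
      (integral_shrinkKernel_pos hL τ (by positivity) (by linarith))]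
    exact h q τ hq hτ hτ1 hKq
  choose C hC q₀ hq₀ h using h
  refine ⟨∑ m ∈ Finset.range (s + 1), C m, Finset.sum_pos (fun m _ => hC m) (by simp),
    ∑ m ∈ Finset.range (s + 1), q₀ m, ?_, fun m hm q τ hq hτ hτ1 hKq => ?_⟩
  · exact (hq₀ 0).le.trans (Finset.single_le_sum (f := q₀)
      (fun m _ => zero_le_one.trans (hq₀ m)) (by simp))
  · have hmem : m ∈ Finset.range (s + 1) := by simp; omega
    have h1 : q₀ m ≤ q := (Finset.single_le_sum (f := q₀)
      (fun m _ => zero_le_one.trans (hq₀ m)) hmem).trans hq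
    have h2 : C m ≤ ∑ m ∈ Finset.range (s + 1), C m :=
      Finset.single_le_sum (f := C) (fun m _ => (hC m).le) hmem
    have hq0 : 0 < q := by linarith [hq₀ m]
    exact (h m q τ h1 hτ hτ1 hKq).trans (by gcongr)

namespace GroupedDesign

variable {n : ℕ} {D : GroupedDesign n}

lemma measurable_leastSquares_apply (g : Fin D.numGroups) (j : Fin (D.size g)) :
    Measurable fun y => D.leastSquares y g j := by
  unfold leastSquares
  simp only [Matrix.mulVec, dotProduct]
  fun_prop

lemma measurable_projSq (g : Fin D.numGroups) : Measurable fun y => D.projSq y g := by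
  unfold projSq score
  simp only [Matrix.mulVec, dotProduct]
  fun_prop

lemma measurable_tauEB (c₁ c₂ σ : ℝ) : Measurable fun y => D.tauEB c₁ c₂ σ y := by
  unfold tauEB
  refine measurable_const.max (measurable_const.mul (Finset.measurable_sum _ fun g _ => ?_))
  refine Measurable.ite (measurableSet_lt measurable_const ?_) measurable_const measurable_const
  have := measurable_leastSquares_apply (D := D) g
  simp only [Matrix.mulVec, dotProduct]
  fun_prop

lemma measurable_activeContrast (β : D.Coef) (α : EuclideanSpace ℝ (D.ActiveIndex β))
    {b : EuclideanSpace ℝ (Fin n) → D.Coef} (hb : ∀ g j, Measurable fun y => b y g j) :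
    Measurable fun y => D.activeContrast β α (b y) := by
  unfold activeContrast activePart
  simp only [Matrix.mulVec, dotProduct, Pi.sub_apply]
  refine Finset.measurable_sum _ fun k _ => measurable_const.mul
    (Finset.measurable_sum _ fun l _ => measurable_const.mul ((hb _ _).sub measurable_const))

/-- The closed form expresses the estimator through measurable functions of the data, including the
plugged-in `τ`. -/
lemma measurable_halfThresholdEB_apply (hD : D.BlockOrthogonal)
    (hX : (D.matrixᵀ * D.matrix).PosDef) (hg : ∀ g, (D.gram g).PosDef) {a : ℝ}
    {L : ℝ → ℝ} (hL : PolynomialTail a L) (c₁ c₂ : ℝ) {σ : ℝ} (hσ : 0 < σ)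
    (g : Fin D.numGroups) (j : Fin (D.size g)) :
    Measurable fun y => D.halfThresholdEB a L c₁ c₂ σ y g j := by
  have hs : Measurable fun y => shrinkMean a L (D.size g / 2) (D.projSq y g / σ ^ 2)
      (D.tauEB c₁ c₂ σ y) :=
    .shrinkMean hL _ (.div_const (measurable_projSq g) _) (measurable_tauEB c₁ c₂ σ)
  have e : (fun y => D.halfThresholdEB a L c₁ c₂ σ y g j) = fun y =>
      if shrinkMean a L (D.size g / 2) (D.projSq y g / σ ^ 2) (D.tauEB c₁ c₂ σ y) < 1 / 2 then
        (1 - shrinkMean a L (D.size g / 2) (D.projSq y g / σ ^ 2) (D.tauEB c₁ c₂ σ y)) *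
          D.leastSquares y g j else 0 := by
    ext y
    rw [halfThresholdEB, halfThreshold_eq hD hX hg hL hσ (tauEB_pos c₁ c₂ σ y g)]
    split_ifs <;> simp
  rw [e]
  exact Measurable.ite (measurableSet_lt hs measurable_const)
    ((measurable_const.sub hs).mul (measurable_leastSquares_apply g j)) measurable_const

/-! ### Signal and noise in the active groups. -/

/-- The event that the noise in the direction of some active group is at least half as large as
the signal of that group. -/
def noisyEvent (β : D.Coef) : Set (EuclideanSpace ℝ (Fin n)) :=
  ⋃ g : {g : Fin D.numGroups // β g ≠ 0},
    {y | (β g ⬝ᵥ (D.gram g *ᵥ β g)) / 2 ≤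
      |inner ℝ (WithLp.toLp 2 (D.block g *ᵥ β g)) (y - D.mean β)|}

lemma measurableSet_noisyEvent (β : D.Coef) : MeasurableSet (noisyEvent β) := by
  refine MeasurableSet.iUnion fun g => measurableSet_le measurable_const ?_
  fun_prop

/-- With `m = ‖X_g β_g‖²`, the noise in that direction has variance `σ² m`; Chebyshev at level `m/2`
gives `4σ²/m`, and the union bound supplies the number of active groups. -/
lemma measure_noisyEvent_le (hD : D.BlockOrthogonal) (σ : ℝ) (β : D.Coef) {c : ℝ} (hc : 0 < c)
    (hβ : ∀ g, β g ≠ 0 → c ≤ β g ⬝ᵥ (D.gram g *ᵥ β g)) :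
    (D.responseLaw σ β).real (noisyEvent β) ≤ D.numActive β * (4 * σ ^ 2 / c) := by
  have : IsProbabilityMeasure (D.responseLaw σ β) := by unfold responseLaw; infer_instance
  refine (measureReal_iUnion_fintype_le _).trans ?_
  have h : ∀ g : {g : Fin D.numGroups // β g ≠ 0},
      (D.responseLaw σ β).real {y | (β g ⬝ᵥ (D.gram g *ᵥ β g)) / 2 ≤
        |inner ℝ (WithLp.toLp 2 (D.block g *ᵥ β g)) (y - D.mean β)|} ≤ 4 * σ ^ 2 / c := by
    rintro ⟨g, hg⟩
    set v : EuclideanSpace ℝ (Fin n) := WithLp.toLp 2 (D.block g *ᵥ β g) with hv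
    have hm := hβ g hg
    set m := β g ⬝ᵥ (D.gram g *ᵥ β g) with hmdef
    have hvm : ‖v‖ ^ 2 = m := by
      rw [← real_inner_self_eq_norm_sq, hv, inner_block_block hD, if_pos rfl]
    have hm0 : 0 < m := hc.trans_le hm
    have hmap := map_inner_sub_multivariateGaussian σ (D.mean β) v
    have e1 : {y | m / 2 ≤ |inner ℝ v (y - D.mean β)|} =
        (fun y => inner ℝ v (y - D.mean β)) ⁻¹' {x : ℝ | m / 2 ≤ |x|} := rfl
    have hms : MeasurableSet {x : ℝ | m / 2 ≤ |x|} := measurableSet_le measurable_const (by fun_prop)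
    rw [measureReal_def, e1, ← Measure.map_apply (by fun_prop) hms, responseLaw, hmap]
    have hcheb := meas_ge_le_variance_div_sq
      (memLp_id_gaussianReal (μ := 0) (v := (σ ^ 2 * ‖v‖ ^ 2).toNNReal) 2)
      (half_pos hm0)
    rw [variance_id_gaussianReal] at hcheb
    simp only [id, integral_id_gaussianReal, sub_zero] at hcheb
    refine (ENNReal.toReal_mono ENNReal.ofReal_ne_top hcheb).trans ?_
    rw [Real.coe_toNNReal _ (by positivity), hvm, ENNReal.toReal_ofReal (by positivity)]
    calc σ ^ 2 * m / (m / 2) ^ 2 = 4 * σ ^ 2 / m := by field_simp; ring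
      _ ≤ 4 * σ ^ 2 / c := by gcongr
  refine (Finset.sum_le_sum fun g _ => h g).trans (le_of_eq ?_)
  rw [Finset.sum_const, nsmul_eq_mul, Finset.card_univ, numActive, Nat.card_eq_fintype_card]

/-- Off the event `⟨X_g β_g, y⟩` is at least `m/2`, where `m = ‖X_g β_g‖²`; projecting onto this
single direction bounds the whole projection below by `(m/2)²/m = m/4`. -/
lemma le_projSq_of_notMem_noisyEvent (hD : D.BlockOrthogonal) (hg : ∀ g, (D.gram g).PosDef)
    {β : D.Coef} {y : EuclideanSpace ℝ (Fin n)} (hy : y ∉ noisyEvent β) {g : Fin D.numGroups}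
    (hβ : β g ≠ 0) {c : ℝ} (hc : 0 < c) (hcβ : c ≤ β g ⬝ᵥ (D.gram g *ᵥ β g)) :
    c / 4 ≤ D.projSq y g := by
  simp only [noisyEvent, Set.mem_iUnion, not_exists, Set.mem_ofPred_eq, not_le] at hy
  have h1 := hy ⟨g, hβ⟩
  simp only at h1
  have h2 := sq_score_dotProduct_le hg y g (β g)
  rw [inner_sub_right, real_inner_comm, inner_block, real_inner_comm, inner_block,
    score_mean hD] at h1
  rw [dotProduct_comm (D.gram g *ᵥ (β g : Fin (D.size g) → ℝ))] at h1
  set m := β g ⬝ᵥ (D.gram g *ᵥ β g)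
  have h3 : m / 2 ≤ D.score y g ⬝ᵥ β g := by linarith [(abs_lt.1 h1).1]
  have hm0 : 0 < m := hc.trans_le hcβ
  have h4 : (m / 2) ^ 2 ≤ D.projSq y g * m := (pow_le_pow_left₀ (by positivity) h3 2).trans h2
  have h5 : m / 4 ≤ D.projSq y g := by
    refine le_of_mul_le_mul_right ?_ hm0
    linarith
  linarith

/-- If the standardised projections onto the active groups are at least `q₁`, the contrast of the
half-thresholding estimator is close to that of least squares. -/
lemma abs_activeContrast_halfThresholdEB_sub_le (hD : D.BlockOrthogonal)
    (hX : (D.matrixᵀ * D.matrix).PosDef) (hg : ∀ g, (D.gram g).PosDef) {a : ℝ}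
    {L : ℝ → ℝ} (hL : PolynomialTail a L) (c₁ c₂ : ℝ) {σ : ℝ} (hσ : 0 < σ) (β : D.Coef)
    (α : EuclideanSpace ℝ (D.ActiveIndex β)) (y : EuclideanSpace ℝ (Fin n)) {C q₁ : ℝ}
    (hq₁ : 0 < q₁) (hC : 2 * C < q₁)
    (hq : ∀ g, β g ≠ 0 → q₁ ≤ D.projSq y g / σ ^ 2)
    (hs : ∀ g, β g ≠ 0 → shrinkMean a L (D.size g / 2) (D.projSq y g / σ ^ 2)
      (D.tauEB c₁ c₂ σ y) ≤ C / (D.projSq y g / σ ^ 2)) :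
    |D.activeContrast β α (D.halfThresholdEB a L c₁ c₂ σ y) -
        D.activeContrast β α (D.leastSquares y)| ≤
      ‖α‖ * √(D.numActive β * (C ^ 2 * σ ^ 2 / q₁)) := by
  classical
  set w : Fin D.numGroups → ℝ := fun g => shrinkMean a L (D.size g / 2) (D.projSq y g / σ ^ 2)
    (D.tauEB c₁ c₂ σ y) with hw
  refine (abs_activeContrast_sub_leastSquares_le hD hX hg β α y w fun g hβ => ?_).trans ?_
  · rw [halfThresholdEB, halfThreshold_eq hD hX hg hL hσ (tauEB_pos c₁ c₂ σ y g), if_pos]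
    -- Since `2C < q₁ ≤ q`, the posterior mean of `κ` is below `1/2` and the group is retained.
    refine (hs g hβ).trans_lt ?_
    have := hq g hβ
    rw [div_lt_iff₀ (by linarith)]
    linarith
  · refine mul_le_mul_of_nonneg_left (Real.sqrt_le_sqrt ?_) (norm_nonneg _)
    calc _ ≤ ∑ g with β g ≠ 0, C ^ 2 * σ ^ 2 / q₁ := by
          refine Finset.sum_le_sum fun g hgm => ?_
          have hβ : β g ≠ 0 := by simpa using hgm
          have hqg := hq g hβ
          have hpq : D.projSq y g = D.projSq y g / σ ^ 2 * σ ^ 2 := by field_simp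
          rw [hpq]
          have hsg : w g ≤ C / (D.projSq y g / σ ^ 2) := hs g hβ
          set q := D.projSq y g / σ ^ 2
          have hq0 : 0 < q := by linarith
          calc w g ^ 2 * (q * σ ^ 2) ≤ (C / q) ^ 2 * (q * σ ^ 2) := by
                gcongr
                exact shrinkMean_nonneg _ _ _
            _ = C ^ 2 * σ ^ 2 / q := by field_simp
            _ ≤ _ := by gcongr
      _ = _ := by
          rw [Finset.sum_const, nsmul_eq_mul, numActive, Nat.card_eq_fintype_card,
            Fintype.card_subtype]

end GroupedDesign

/-! ### Sparsity and the conclusion. -/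

lemma EuclideanSpace.sq_le_norm_sq_of_forall_lt_abs {ι : Type*} [Fintype ι]
    {b : EuclideanSpace ℝ ι} (hb : b ≠ 0) {c : ℝ} (hc : 0 < c) (h : ∀ j, c < |b j|) :
    c ^ 2 ≤ ‖b‖ ^ 2 := by
  -- Being nonzero serves only to exclude an empty index type.
  have : ∃ j, b j ≠ 0 := by
    by_contra hcon
    push Not at hcon
    exact hb (by ext j; simpa using hcon j)
  obtain ⟨j, -⟩ := this
  have h1 := PiLp.norm_apply_le b j
  rw [Real.norm_eq_abs] at h1
  exact pow_le_pow_left₀ hc.le ((h j).le.trans h1) 2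

/-- Sparsity: the number of active groups is negligible compared with the sample size. -/
lemma tendsto_div_natCast_of_isBigO_rpow {u G : ℕ → ℕ} (hG : ∀ n, G n ≤ n) {ε : ℝ} (hε : 0 ≤ ε)
    (hε1 : ε < 1) (h : (fun n => (u n : ℝ)) =O[atTop] fun n => (G n : ℝ) ^ ε) :
    Tendsto (fun n => (u n : ℝ) / n) atTop (𝓝 0) := by
  obtain ⟨c, hc, hb⟩ := h.exists_pos
  have hlim : Tendsto (fun n : ℕ => c * (n : ℝ) ^ (-(1 - ε))) atTop (𝓝 0) := by
    simpa using ((tendsto_rpow_neg_atTop (by linarith : 0 < 1 - ε)).comp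
      tendsto_natCast_atTop_atTop).const_mul c
  refine squeeze_zero' (Eventually.of_forall fun n => by positivity) ?_ hlim
  filter_upwards [hb.bound, eventually_gt_atTop 0] with n hn hn0
  have hn0' : (0 : ℝ) < n := by exact_mod_cast hn0
  rw [Real.norm_of_nonneg (by positivity), Real.norm_of_nonneg (by positivity)] at hn
  have hGn : (G n : ℝ) ≤ n := by exact_mod_cast hG n
  rw [div_le_iff₀ hn0', mul_assoc, ← Real.rpow_add_one hn0'.ne',
    show -(1 - ε) + 1 = ε by ring]
  exact hn.trans (by gcongr)

theorem theorem4
    (D : (n : ℕ) → GroupedDesign n)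
    (hGn : ∀ n, (D n).numGroups ≤ n)
    (hblock : ∀ n, (D n).BlockOrthogonal)
    (s : ℕ) (hsize : ∀ n g, (D n).size g ≤ s)
    (σ : ℝ) (hσ : 0 < σ)
    (β₀ : (n : ℕ) → (D n).Coef)
    {Ω : ℕ → Type*} [∀ n, MeasurableSpace (Ω n)]
    (P : (n : ℕ) → Measure (Ω n)) [∀ n, IsProbabilityMeasure (P n)]
    (y : (n : ℕ) → Ω n → EuclideanSpace ℝ (Fin n))
    (hy : ∀ n, HasLaw (y n) ((D n).responseLaw σ (β₀ n)) (P n))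
    (a : ℝ) (L : ℝ → ℝ) (hL : PolynomialTail a L) (hL' : TailBounds a L)
    (c₁ c₂ : ℝ) (hc₁ : 2 ≤ c₁) (hc₂ : 1 ≤ c₂)
    (ε₁ ε₂ : ℝ) (hε₁ : 0 ≤ ε₁) (hε : ε₁ < ε₂) (hε₂ : ε₂ < 1 / 2)
    (hlower : (fun n => ((D n).numGroups : ℝ) ^ ε₁) =O[atTop]
      fun n => ((D n).numActive (β₀ n) : ℝ))
    (hupper : (fun n => ((D n).numActive (β₀ n) : ℝ)) =O[atTop]
      fun n => ((D n).numGroups : ℝ) ^ ε₂)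
    (C₁ C₂ : ℝ) (hC₁ : 0 < C₁) (hC₂ : C₁ ≤ C₂)
    (heig : ∀ n, (D n).EigenvalueBounds C₁ C₂)
    (C₃ : ℝ) (hC₃ : 0 < C₃)
    (hsignal : ∀ n g, β₀ n g ≠ 0 → ∀ j, C₃ < |β₀ n g j|)
    (α : (n : ℕ) → EuclideanSpace ℝ ((D n).ActiveIndex (β₀ n)))
    (hα : ∀ᶠ n in atTop, ‖α n‖ = 1) :
    TendstoInDistribution
      (fun n ω => (D n).activeContrast (β₀ n) (α n)
        ((D n).halfThresholdEB a L c₁ c₂ σ (y n ω)))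
      atTop (id : ℝ → ℝ) P (gaussianReal 0 (Real.toNNReal (σ ^ 2))) := by
  have hposX := fun n => (heig n).posDef_fullGram hC₁
  have hposg := fun n => (heig n).posDef_gram hC₁
  have hT : ∀ n, Measurable fun y => (D n).activeContrast (β₀ n) (α n)
      ((D n).halfThresholdEB a L c₁ c₂ σ y) := fun n =>
    GroupedDesign.measurable_activeContrast _ _
      (GroupedDesign.measurable_halfThresholdEB_apply (hblock n) (hposX n) (hposg n) hL c₁ c₂ hσ)
  have hprob : ∀ n, IsProbabilityMeasure ((D n).responseLaw σ (β₀ n)) := fun n => by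
    unfold GroupedDesign.responseLaw; infer_instance
  -- Only the law of the response matters, so the argument moves to the sample spaces themselves.
  have hmap : ∀ n, (P n).map (fun ω => (D n).activeContrast (β₀ n) (α n)
      ((D n).halfThresholdEB a L c₁ c₂ σ (y n ω))) =
      ((D n).responseLaw σ (β₀ n)).map fun y => (D n).activeContrast (β₀ n) (α n)
        ((D n).halfThresholdEB a L c₁ c₂ σ y) := fun n => by
    rw [← (hy n).map_eq, AEMeasurable.map_map_of_aemeasurable (hT n).aemeasurable
      (hy n).aemeasurable]
    rfl
  refine ⟨fun n => (hT n).comp_aemeasurable (hy n).aemeasurable, aemeasurable_id,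
    ProbabilityMeasure.tendsto_of_tendsto_charFun fun t => ?_⟩
  simp only [ProbabilityMeasure.coe_mk, Measure.map_id, hmap]
  have hsparse := tendsto_div_natCast_of_isBigO_rpow hGn (by linarith) (by linarith) hupper
  have hsig : ∀ n g, β₀ n g ≠ 0 →
      C₁ * C₃ ^ 2 * n ≤ β₀ n g ⬝ᵥ ((D n).gram g *ᵥ β₀ n g) := fun n g hg => by
    refine le_trans ?_ ((heig n).le_dotProduct_gram hC₁ g (β₀ n g))
    have := EuclideanSpace.sq_le_norm_sq_of_forall_lt_abs hg hC₃ (hsignal n g hg)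
    calc C₁ * C₃ ^ 2 * n = C₁ * n * C₃ ^ 2 := by ring
      _ ≤ _ := by gcongr
  -- This `κ` is not a shrinkage factor: `κ n` is the lower bound for `q_g` in active groups. The
  -- signal is at least `C₁ C₃² n`, and a quarter of it survives the noise.
  set κ := C₁ * C₃ ^ 2 / (4 * σ ^ 2) with hκ
  have hκ0 : 0 < κ := by positivity
  -- The choice `K = 1/κ` fits `1/τ ≤ G ≤ n ≤ q/κ`.
  obtain ⟨C, hC, q₀, hq₀, hshrink⟩ := exists_shrinkMean_le hL hL' s (K := 1 / κ) (by positivity)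
  have hκn : Tendsto (fun n : ℕ => κ * (n : ℝ)) atTop atTop :=
    tendsto_natCast_atTop_atTop.const_mul_atTop hκ0
  refine tendsto_charFun_of_close (fun n => (D n).responseLaw σ (β₀ n)) _
    (X := fun n y => inner ℝ (GroupedDesign.contrastVec (β₀ n) (α n)) (y - (D n).mean (β₀ n)))
    (fun n => by fun_prop) hT ?_
    (fun n => GroupedDesign.measurableSet_noisyEvent (β₀ n)) ?_
    (δ := fun n => √((D n).numActive (β₀ n) / n * (C ^ 2 * σ ^ 2 / κ))) ?_ ?_ t
  · filter_upwards [hα] with n hn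
    rw [GroupedDesign.responseLaw, map_inner_sub_multivariateGaussian,
      GroupedDesign.norm_contrastVec (hposX n), hn, one_pow, mul_one]
  · have hlim : Tendsto (fun n => (D n).numActive (β₀ n) / (n : ℝ) *
        (4 * σ ^ 2 / (C₁ * C₃ ^ 2))) atTop (𝓝 0) := by
      simpa using hsparse.mul_const (4 * σ ^ 2 / (C₁ * C₃ ^ 2))
    refine squeeze_zero' (Eventually.of_forall fun n => measureReal_nonneg) ?_ hlim
    filter_upwards [eventually_gt_atTop 0] with n hn
    have hn' : (0 : ℝ) < n := by exact_mod_cast hn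
    refine (GroupedDesign.measure_noisyEvent_le (hblock n) σ (β₀ n)
      (by positivity : 0 < C₁ * C₃ ^ 2 * n) (hsig n)).trans (le_of_eq ?_)
    field_simp
  · have := (hsparse.mul_const (C ^ 2 * σ ^ 2 / κ)).sqrt
    simpa using this
  · filter_upwards [hα, eventually_gt_atTop 0, hκn.eventually_ge_atTop q₀,
      hκn.eventually_gt_atTop (2 * C)] with n hn hn0 hnq hnC x hx
    have hn' : (0 : ℝ) < n := by exact_mod_cast hn0
    have hproj : ∀ g, β₀ n g ≠ 0 → κ * n ≤ (D n).projSq x g / σ ^ 2 := fun g hg => by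
      have := GroupedDesign.le_projSq_of_notMem_noisyEvent (hblock n) (hposg n) hx hg
        (by positivity : 0 < C₁ * C₃ ^ 2 * n) (hsig n g hg)
      rw [le_div_iff₀ (by positivity), hκ]
      refine le_trans (le_of_eq ?_) this
      field_simp
    rw [← GroupedDesign.activeContrast_leastSquares (hblock n) (hposX n) (hposg n)]
    refine (GroupedDesign.abs_activeContrast_halfThresholdEB_sub_le (hblock n) (hposX n)
      (hposg n) hL c₁ c₂ hσ (β₀ n) (α n) x (by positivity : 0 < κ * n) hnC hproj
      fun g hg => ?_).trans (le_of_eq ?_)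
    · have hq := hproj g hg
      have hG : (0 : ℝ) < (D n).numGroups := by exact_mod_cast g.pos
      have hτ := GroupedDesign.tauEB_pos (D := D n) c₁ c₂ σ x g
      refine hshrink _ (hsize n g) _ _ (hnq.trans hq) hτ
        (GroupedDesign.tauEB_le_one c₁ hc₂ σ x g) ?_
      have h1 : 1 / (D n).tauEB c₁ c₂ σ x ≤ (D n).numGroups := by
        have := one_div_le_one_div_of_le (by positivity)
          (GroupedDesign.one_div_le_tauEB (D := D n) c₁ c₂ σ x)
        rwa [one_div_one_div] at this
      have h2 : ((D n).numGroups : ℝ) ≤ n := by exact_mod_cast hGn n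
      rw [one_div_mul_eq_div, le_div_iff₀ hκ0]
      nlinarith
    · rw [hn, one_mul]
      congr 1
      field_simp
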